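/- **Theorem (Continuous dependence of the finite element solution on the mesh).** Let $\Omega=(0,1)$, $a,b\in W^{1,\infty}(\Omega)$, $c\in L^\infty(\Omega)$, with $a\ge a_0$ and $c-\tfrac12 b'\ge 0$ a.e. in $\Omega$ for some constant $a_0>0$. Put $$B(u,v)=\int_\Omega (a u'v'+b u'v+c uv)\,dx,\qquad (f,v)=\int_\Omega fv\,dx,\qquad \|v\|_E^2=\int_\Omega\left(a v'^2+(c-\tfrac12 b')v^2\right)dx .$$ Assume $f\in L^\infty(\Omega)$, and let $u\in H^1_0(\Omega)$ satisfy $B(u,v)=(f,v)$ for all $v\in H^1_0(\Omega)$; assume $u\in H^2(\Omega)$. Let $\gamma>0$ and $$r=f+a'u'-bu'-cu,\qquad \rho_0=\left[1+\gamma\left(\frac{\|r\|_{L^\infty(\Omega)}}{\|r\|_{L^{2/3}(\Omega)}}\right)^{2/3}\right]^2,\qquad \|r\|_{L^{2/3}(\Omega)}=\left(\int_\Omega |r|^{2/3}dx\right)^{3/2},$$ where the quotient is read as $0$ if $r=0$ a.e. For an integer $N\ge 1$ let $$S_N=\left\{X=(x_1,\dots,x_{N-1})\in\mathbb R^{N-1}:\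 0=x_0<x_1<\dots<x_N=1,\ \ \frac1{\rho_0N}\le x_i-x_{i-1}\le\frac2N,\ i=1,\dots,N\right\},$$ with the maximum norm $\|\cdot\|_\infty$ on $\mathbb R^{N-1}$ (which is $0$ if $N=1$). For $X\in S_N$ let $V_h$ be the span of the piecewise linear hat functions $\phi_1,\dots,\phi_{N-1}$ associated with the nodes $x_1,\dots,x_{N-1}$, and let the linear finite element solution on $X$ be the $u_h\in V_h$ with $B(u_h,v_h)=(f,v_h)$ for all $v_h\in V_h$. Then there is a constant $C>0$, depending only on $a,b,c,f,u,\gamma$ (not on $N$ or the meshes), such that for all $N\ge1$ and all $X,\tilde X\in S_N$ with $\|X-\tilde X\|_\infty<\frac{1}{\rho_0N}$, the linear finite element solutions $u_h$ on $X$ and $u_{\tilde h}$ on $\tilde X$ satisfy $$\|(u_h-u_{\tilde h})'\|_{L^1(\Omega)}\le CN\|X-\tilde X\|_\infty,$$ $$\|u_h-u_{\tilde h}\|_{L^2(\Omega)}\le CN^{-1/2}\|X-\tilde X\|_\infty^{1/2},$$ $$\left|\,\|u_h\|_E^2-\|u_{\tilde h}\|_E^2\right|\le CN^{-1/2}\|X-\tilde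 X\|_\infty^{1/2}.$$ -/

import Mathlib

open MeasureTheory Set
open scoped ContDiff ENNReal

noncomputable section

namespace FEMesh

/-- The domain `Ω = (0,1)`. -/
abbrev Omega : Set ℝ := Ioo (0 : ℝ) 1

/-- Lebesgue measure on `Ω`. -/
abbrev volOmega : Measure ℝ := volume.restrict Omega

/-- `w` is a weak (distributional) derivative of `v` on `Ω`. -/
def HasWeakDeriv (v w : ℝ → ℝ) : Prop :=
  LocallyIntegrableOn v Omega ∧ LocallyIntegrableOn w Omega ∧
    ∀ φ : ℝ → ℝ, ContDiff ℝ ∞ φ → HasCompactSupport φ → tsupport φ ⊆ Omega →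
      ∫ x in Omega, v x * deriv φ x = -∫ x in Omega, w x * φ x

open Classical in
/-- The weak derivative of `v` on `Ω` (determined up to null sets; `0` if there is none). -/
def weakDeriv (v : ℝ → ℝ) : ℝ → ℝ :=
  if h : ∃ w, HasWeakDeriv v w then h.choose else 0

/-- Membership in the Sobolev space `W^{1,p}(Ω)`. -/
def MemW1 (p : ℝ≥0∞) (v : ℝ → ℝ) : Prop :=
  MemLp v p volOmega ∧ HasWeakDeriv v (weakDeriv v) ∧ MemLp (weakDeriv v) p volOmega

/-- Membership in `H²(Ω)`. -/
def MemH2 (v : ℝ → ℝ) : Prop :=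
  MemW1 2 v ∧ MemW1 2 (weakDeriv v)

/-- Membership in `H¹₀(Ω)`: functions in `H¹(Ω)` whose continuous representative on `[0,1]`
vanishes at both end points. -/
def MemH10 (v : ℝ → ℝ) : Prop :=
  MemW1 2 v ∧ ∃ g : ℝ → ℝ, ContinuousOn g (Icc 0 1) ∧ v =ᵐ[volOmega] g ∧ g 0 = 0 ∧ g 1 = 0

/-- The bilinear form `B(u,v) = ∫_Ω (a u' v' + b u' v + c u v) dx`. -/
def bilin (a b c u v : ℝ → ℝ) : ℝ :=
  ∫ x in Omega, (a x * weakDeriv u x * weakDeriv v x + b x * weakDeriv u x * v x + c x * u x * v x)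

/-- The `L²` pairing `(f,v) = ∫_Ω f v dx`. -/
def pairing (f v : ℝ → ℝ) : ℝ := ∫ x in Omega, f x * v x

/-- The squared energy norm `‖v‖_E² = ∫_Ω (a v'² + (c - b'/2) v²) dx`. -/
def energySq (a b c v : ℝ → ℝ) : ℝ :=
  ∫ x in Omega, (a x * weakDeriv v x ^ 2 + (c x - 1 / 2 * weakDeriv b x) * v x ^ 2)

/-- `u ∈ H¹₀(Ω)` is the weak solution of `-(a u')' + b u' + c u = f`, `u(0) = u(1) = 0`. -/
def IsWeakSolution (a b c f u : ℝ → ℝ) : Prop :=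
  MemH10 u ∧ ∀ v, MemH10 v → bilin a b c u v = pairing f v

/-- The residual `r = f + a' u' - b u' - c u`. -/
def residual (a b c f u : ℝ → ℝ) : ℝ → ℝ := fun x =>
  f x + weakDeriv a x * weakDeriv u x - b x * weakDeriv u x - c x * u x

/-- `ρ₀ = [1 + γ (‖r‖_{L^∞} / ‖r‖_{L^{2/3}})^{2/3}]²`, where
`‖r‖_{L^{2/3}} = (∫_Ω |r|^{2/3} dx)^{3/2}`. -/
def rho0 (γ : ℝ) (r : ℝ → ℝ) : ℝ :=
  (1 + γ * ((eLpNorm r ⊤ volOmega).toReal /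
    (eLpNorm r (2 / 3) volOmega).toReal) ^ (2 / 3 : ℝ)) ^ 2

/-- The nodes `x_0 = 0, x_1, …, x_{N-1}, x_N = 1` of the mesh `X = (x_1, …, x_{N-1})`
(the entry `x_j` is `X ⟨j - 1, _⟩`). -/
def node {N : ℕ} (X : Fin (N - 1) → ℝ) (j : ℕ) : ℝ :=
  if j = 0 then 0 else if h : j - 1 < N - 1 then X ⟨j - 1, h⟩ else 1

/-- The set `S_N` of meshes with `1/(ρ₀ N) ≤ x_j - x_{j-1} ≤ 2/N`. -/
def meshSet (ρ : ℝ) (N : ℕ) : Set (Fin (N - 1) → ℝ) :=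
  {X | ∀ j < N, node X j < node X (j + 1) ∧
    1 / (ρ * N) ≤ node X (j + 1) - node X j ∧ node X (j + 1) - node X j ≤ 2 / N}

/-- The linear basis (hat) function that is `0` outside `(l, r)`, `1` at `m`, and
linear on `[l, m]` and on `[m, r]`. -/
def hat (l m r : ℝ) (t : ℝ) : ℝ :=
  max 0 (min ((t - l) / (m - l)) ((r - t) / (r - m)))

/-- The linear finite element space `V_h = span {φ_1, …, φ_{N-1}}`. -/
def feSpace {N : ℕ} (X : Fin (N - 1) → ℝ) : Submodule ℝ (ℝ → ℝ) :=
  Submodule.span ℝ (range fun i : Fin (N - 1) =>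
    hat (node X i) (node X (i + 1)) (node X (i + 2)))

/-- `w` is the linear finite element solution on the mesh `X`. -/
def IsFESolution (a b c f : ℝ → ℝ) {N : ℕ} (X : Fin (N - 1) → ℝ) (w : ℝ → ℝ) : Prop :=
  w ∈ feSpace X ∧ ∀ v ∈ feSpace X, bilin a b c w v = pairing f v

end FEMesh

end

noncomputable section

namespace FEMesh

/-! Write `δ = ‖X - Y‖`. The argument combines a perturbation bound in `W^{1,1}`, of size `N δ`,
with an approximation bound in `L¹`, of size `N⁻²`.

Perturbation (`integral_abs_weakDeriv_sub_le`). Functions on the two meshes are compared through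
their nodal values: `V` on `Y` carries the nodal values of `uX`. Moving the nodes by `δ` changes
each cell length by at most `2δ`, and cells have length at least a fixed multiple of `1/N`. The
slopes therefore change by a relative amount `O(N δ)`, apart from strips of width `δ` at the nodes,
where the derivatives may differ by `O(1)`. Because of these strips the derivatives are close in
`L¹` only; but products of two derivatives are close in `L¹` as well, so the bilinear form is stable
under the transfer (`SameNodal.abs_bilin_sub_le`). Subtracting the two discrete equations and using
coercivity bounds the `H¹` seminorm of `uY - V` by `O(N δ)`; adding the `L¹` bound for `(uX - V)'`
gives the first estimate.

Approximation (`IsMesh.integral_abs_sub_solution_le`). The finite element solution is superclose to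
the nodal interpolant `I` of `u`: with `e = uX - I`, Galerkin orthogonality gives `B(e,e) = B(u - I,
e)`. Since `e'` is constant on cells and `u - I` vanishes at the nodes, integration by parts on each
cell removes the derivative from `u - I`. The interpolation error is `O(N⁻²)` in the norms needed
because `u ∈ H²`, so no duality argument is required.

Conclusion (`sqrt_integral_sq_le`). For `w = uX - uY`, `‖w‖_∞ ≤ ‖w'‖₁`, hence `‖w‖₂² ≤ ‖w'‖₁ ‖w‖₁ =
O(N δ · N⁻²) = O(δ/N)`. The energy of a discrete solution equals `(f, u_h)`, so the energy gap is at
most `‖f‖_∞ ‖w‖₁`, and `‖w‖₁² ≤ ‖w'‖₁ ‖w‖₁` bounds it in the same way. -/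

/-! ### Weak derivatives and absolutely continuous representatives. -/

theorem integrable_mul_test {w φ : ℝ → ℝ} (hw : LocallyIntegrableOn w Omega)
    (hφ : Continuous φ) (hc : HasCompactSupport φ) (hs : tsupport φ ⊆ Omega) :
    Integrable (fun x => w x * φ x) := by
  have h1 : IntegrableOn w (tsupport φ) := hw.integrableOn_compact_subset hs hc
  have h2 : IntegrableOn (fun x => w x * φ x) (tsupport φ) :=
    h1.mul_continuousOn hφ.continuousOn hc
  refine (integrableOn_iff_integrable_of_support_subset ?_).1 h2
  intro x hx
  apply subset_tsupport
  intro h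
  exact hx (by simp [h])

theorem setIntegral_test {w φ : ℝ → ℝ} (hs : tsupport φ ⊆ Omega) :
    ∫ x in Omega, w x * φ x = ∫ x, w x * φ x := by
  apply setIntegral_eq_integral_of_forall_compl_eq_zero
  intro x hx
  rw [image_eq_zero_of_notMem_tsupport (fun h => hx (hs h)), mul_zero]

theorem ae_eq_of_integral_test {w w' : ℝ → ℝ} (hw : LocallyIntegrableOn w Omega)
    (hw' : LocallyIntegrableOn w' Omega)
    (h : ∀ φ : ℝ → ℝ, ContDiff ℝ ∞ φ → HasCompactSupport φ → tsupport φ ⊆ Omega →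
      ∫ x in Omega, w x * φ x = ∫ x in Omega, w' x * φ x) :
    w =ᵐ[volOmega] w' := by
  have := isOpen_Ioo.ae_eq_zero_of_integral_contDiff_smul_eq_zero (μ := volume) (hw.sub hw') ?_
  · rw [Filter.EventuallyEq, ae_restrict_iff' measurableSet_Ioo]
    filter_upwards [this] with x hx hx'
    exact sub_eq_zero.1 (hx hx')
  · intro φ h1 h2 h3
    have := h φ h1 h2 h3
    rw [setIntegral_test h3, setIntegral_test h3] at this
    simp only [smul_eq_mul, Pi.sub_apply, mul_sub]
    rw [integral_sub]
    · simp only [mul_comm (φ _)]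
      rw [this, sub_self]
    · simpa only [mul_comm] using integrable_mul_test hw h1.continuous h2 h3
    · simpa only [mul_comm] using integrable_mul_test hw' h1.continuous h2 h3

theorem HasWeakDeriv.ae_unique {v w w' : ℝ → ℝ} (h : HasWeakDeriv v w) (h' : HasWeakDeriv v w') :
    w =ᵐ[volOmega] w' := by
  apply ae_eq_of_integral_test h.2.1 h'.2.1
  intro φ h1 h2 h3
  have := h.2.2 φ h1 h2 h3
  rw [h'.2.2 φ h1 h2 h3] at this
  linarith

/-- `weakDeriv` is obtained by choice; this is how it gets computed from a concrete candidate. -/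
theorem HasWeakDeriv.weakDeriv_ae {v w : ℝ → ℝ} (h : HasWeakDeriv v w) :
    weakDeriv v =ᵐ[volOmega] w := by
  have h0 : ∃ w, HasWeakDeriv v w := ⟨w, h⟩
  have : HasWeakDeriv v (weakDeriv v) := by
    unfold weakDeriv
    rw [dif_pos h0]
    exact h0.choose_spec
  exact this.ae_unique h

/-- Absolute continuity on `[0,1]`. -/
abbrev AC (g : ℝ → ℝ) : Prop := AbsolutelyContinuousOnInterval g 0 1

theorem AC.continuousOn_Icc {g : ℝ → ℝ} (hg : AC g) : ContinuousOn g (Icc 0 1) := by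
  simpa using AbsolutelyContinuousOnInterval.continuousOn hg

theorem AC.integrable_deriv {g : ℝ → ℝ} (hg : AC g) : Integrable (deriv g) volOmega := by
  have := AbsolutelyContinuousOnInterval.intervalIntegrable_deriv hg
  rwa [intervalIntegrable_iff_integrableOn_Ioo_of_le zero_le_one] at this

theorem integrable_of_continuousOn_Icc {g : ℝ → ℝ} (hg : ContinuousOn g (Icc 0 1)) :
    Integrable g volOmega :=
  (hg.integrableOn_Icc).mono_set Ioo_subset_Icc_self

theorem AC.integrable {g : ℝ → ℝ} (hg : AC g) : Integrable g volOmega :=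
  integrable_of_continuousOn_Icc hg.continuousOn_Icc

theorem intervalIntegral_eq_integral_Omega (g : ℝ → ℝ) :
    ∫ x in (0 : ℝ)..1, g x = ∫ x in Omega, g x := by
  rw [intervalIntegral.integral_of_le zero_le_one, integral_Ioc_eq_integral_Ioo]

theorem contDiff_ac {g : ℝ → ℝ} (hg : ContDiff ℝ ∞ g) : AC g :=
  ContDiffOn.absolutelyContinuousOnInterval (hg.of_le (by norm_cast)).contDiffOn

theorem AC.hasWeakDeriv {g : ℝ → ℝ} (hg : AC g) : HasWeakDeriv g (deriv g) := by
  refine ⟨IntegrableOn.locallyIntegrableOn hg.integrable,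
    IntegrableOn.locallyIntegrableOn hg.integrable_deriv, fun φ h1 h2 h3 => ?_⟩
  have h := AbsolutelyContinuousOnInterval.integral_mul_deriv_eq_deriv_mul hg (contDiff_ac h1)
  have h0 : φ 0 = 0 := image_eq_zero_of_notMem_tsupport (fun h => by simpa using h3 h)
  have h1 : φ 1 = 0 := image_eq_zero_of_notMem_tsupport (fun h => by simpa using h3 h)
  rw [intervalIntegral_eq_integral_Omega, intervalIntegral_eq_integral_Omega, h0, h1] at h
  linarith

theorem AC.weakDeriv_ae {g : ℝ → ℝ} (hg : AC g) : weakDeriv g =ᵐ[volOmega] deriv g :=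
  hg.hasWeakDeriv.weakDeriv_ae

/-- The primitive of a test function of zero mean is a test function. -/
theorem exists_test_primitive {θ : ℝ → ℝ} (h1 : ContDiff ℝ ∞ θ) (h2 : HasCompactSupport θ)
    (h3 : tsupport θ ⊆ Omega) (h0 : ∫ x, θ x = 0) :
    ∃ Φ : ℝ → ℝ, ContDiff ℝ ∞ Φ ∧ HasCompactSupport Φ ∧ tsupport Φ ⊆ Omega ∧ deriv Φ = θ := by
  obtain ⟨α, β, hα, hβ, hs⟩ : ∃ α β : ℝ, 0 < α ∧ β < 1 ∧ ∀ x, θ x ≠ 0 → x ∈ Ioo α β := by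
    rcases (tsupport θ).eq_empty_or_nonempty with he | hne
    · refine ⟨1/2, 1/2, by norm_num, by norm_num, fun x hx => ?_⟩
      have := subset_tsupport θ hx
      rw [he] at this
      exact this.elim
    · obtain ⟨l, hl⟩ := IsCompact.exists_isLeast h2 hne
      obtain ⟨r, hr⟩ := IsCompact.exists_isGreatest h2 hne
      have := h3 hl.1
      have := h3 hr.1
      simp only [mem_Ioo] at *
      -- The support has extreme points `l > 0` and `r < 1`; halving the gaps to the end points
      -- leaves it strictly inside a smaller interval.
      refine ⟨l/2, (r+1)/2, by linarith, by linarith, fun x hx => ?_⟩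
      have := subset_tsupport θ hx
      have := hl.2 this
      have := hr.2 ‹x ∈ tsupport θ›
      constructor <;> linarith
  have hd : ∀ x, HasDerivAt (fun x => ∫ t in α..x, θ t) (θ x) x := fun x =>
    intervalIntegral.integral_hasDerivAt_right (h1.continuous.intervalIntegrable _ _)
      h1.continuous.stronglyMeasurable.stronglyMeasurableAtFilter h1.continuous.continuousAt
  have hder : deriv (fun x => ∫ t in α..x, θ t) = θ := funext fun x => (hd x).deriv
  have hsub : tsupport (fun x => ∫ t in α..x, θ t) ⊆ Icc α β := by
    apply closure_minimal _ isClosed_Icc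
    intro x hx
    by_contra hx'
    apply hx
    beta_reduce
    rcases lt_or_ge x α with h | h
    · rw [intervalIntegral.integral_symm, intervalIntegral.integral_of_le h.le, neg_eq_zero]
      apply setIntegral_eq_zero_of_forall_eq_zero
      intro t ht
      by_contra h
      exact absurd (hs t h).1 (not_lt.2 ht.2)
    · have hb : β < x := by
        by_contra h'
        exact hx' ⟨h, not_lt.1 h'⟩
      -- Right of `β` the primitive has collected the whole integral of `θ`, which is zero.
      rw [← h0]
      apply intervalIntegral.integral_eq_integral_of_support_subset
      intro t ht
      exact ⟨(hs t ht).1, (hs t ht).2.le.trans hb.le⟩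
  refine ⟨_, ?_, ?_, ?_, hder⟩
  · rw [contDiff_infty_iff_deriv, hder]
    exact ⟨fun x => (hd x).differentiableAt, h1⟩
  · exact IsCompact.of_isClosed_subset isCompact_Icc (isClosed_tsupport _) hsub
  · exact hsub.trans fun x hx => ⟨hα.trans_le hx.1, hx.2.trans_lt hβ⟩

/-- The du Bois-Reymond lemma. -/
theorem ae_const_of_integral_mul_deriv_eq_zero {v : ℝ → ℝ} (hv : Integrable v volOmega)
    (h : ∀ φ : ℝ → ℝ, ContDiff ℝ ∞ φ → HasCompactSupport φ → tsupport φ ⊆ Omega →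
      ∫ x in Omega, v x * deriv φ x = 0) : ∃ k : ℝ, v =ᵐ[volOmega] fun _ => k := by
  let ψ : ContDiffBump (1 / 2 : ℝ) := ⟨1 / 8, 1 / 4, by norm_num, by norm_num⟩
  set η := ψ.normed volume with hη
  have e1 : ContDiff ℝ ∞ η := ψ.contDiff_normed
  have e2 : HasCompactSupport η := ψ.hasCompactSupport_normed
  have e3 : tsupport η ⊆ Omega := by
    rw [hη, ψ.tsupport_normed_eq, Real.closedBall_eq_Icc]
    intro x hx
    simp only [mem_Icc, ψ] at hx
    constructor <;> linarith [hx.1, hx.2]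
  have e4 : ∫ x, η x = 1 := ψ.integral_normed
  have hvl : LocallyIntegrableOn v Omega := IntegrableOn.locallyIntegrableOn hv
  refine ⟨∫ x in Omega, v x * η x, ae_eq_of_integral_test hvl
    (locallyIntegrableOn_const _) fun φ h1 h2 h3 => ?_⟩
  have hφi : Integrable φ := h1.continuous.integrable_of_hasCompactSupport h2
  have hηi : Integrable η := e1.continuous.integrable_of_hasCompactSupport e2
  have hts : tsupport (fun x => φ x - (∫ y, φ y) * η x) ⊆ tsupport φ ∪ tsupport η := by
    apply closure_minimal _ ((isClosed_tsupport _).union (isClosed_tsupport _))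
    intro x hx
    by_contra hx'
    rw [mem_union, not_or] at hx'
    apply hx
    beta_reduce
    simp [image_eq_zero_of_notMem_tsupport hx'.1, image_eq_zero_of_notMem_tsupport hx'.2]
  -- Removing the mean of `φ` by a multiple of the unit-mass bump `η` yields a test function with a
  -- primitive; testing with that primitive shows that `v` acts on `φ` as the constant `∫ v η`.
  obtain ⟨Φ, f1, f2, f3, f4⟩ := exists_test_primitive (θ := fun x => φ x - (∫ y, φ y) * η x)
    (h1.sub (contDiff_const.mul e1))
    (IsCompact.of_isClosed_subset (IsCompact.union h2 e2) (isClosed_tsupport _) hts)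
    (hts.trans (union_subset h3 e3))
    (by rw [integral_sub hφi (hηi.const_mul _), integral_const_mul, e4]; ring)
  have key := h Φ f1 f2 f3
  rw [f4] at key
  simp only [mul_sub, mul_left_comm _ (∫ y, φ y)] at key
  rw [integral_sub (integrable_mul_test hvl h1.continuous h2 h3).integrableOn
    ((integrable_mul_test hvl e1.continuous e2 e3).integrableOn.const_mul _),
    integral_const_mul] at key
  rw [integral_const_mul]
  have : ∫ x in Omega, φ x = ∫ x, φ x := by
    simpa using setIntegral_test (w := fun _ => 1) h3
  rw [this]
  linarith

theorem ac_primitive {w : ℝ → ℝ} (hw : Integrable w volOmega) :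
    AC (fun x => ∫ t in (0 : ℝ)..x, w t) ∧
      deriv (fun x => ∫ t in (0 : ℝ)..x, w t) =ᵐ[volOmega] w := by
  have hi : IntervalIntegrable w volume 0 1 :=
    (intervalIntegrable_iff_integrableOn_Ioo_of_le zero_le_one).2 hw
  refine ⟨hi.absolutelyContinuousOnInterval_intervalIntegral (by simp), ?_⟩
  rw [Filter.EventuallyEq, ae_restrict_iff' measurableSet_Ioo]
  filter_upwards [hi.ae_hasDerivAt_integral] with x hx hx'
  exact (hx (by simpa using ⟨hx'.1.le, hx'.2.le⟩) 0 (by simp)).deriv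

theorem ac_const (k : ℝ) : AC (fun _ => k) := contDiff_ac contDiff_const

theorem AC.ae_differentiableAt {g : ℝ → ℝ} (hg : AC g) :
    ∀ᵐ x ∂volOmega, DifferentiableAt ℝ g x := by
  rw [ae_restrict_iff' measurableSet_Ioo]
  filter_upwards [AbsolutelyContinuousOnInterval.ae_differentiableAt hg] with x hx hx'
  exact hx (by simpa using ⟨hx'.1.le, hx'.2.le⟩)

/-- The difference between `v` and the primitive of `w` has weak derivative zero, so du Bois-Reymond
makes it constant. -/
theorem HasWeakDeriv.exists_ac {v w : ℝ → ℝ} (h : HasWeakDeriv v w) (hv : Integrable v volOmega)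
    (hw : Integrable w volOmega) :
    ∃ g, AC g ∧ v =ᵐ[volOmega] g ∧ w =ᵐ[volOmega] deriv g := by
  obtain ⟨hg, hd⟩ := ac_primitive hw
  set g := fun x => ∫ t in (0 : ℝ)..x, w t
  obtain ⟨k, hk⟩ := ae_const_of_integral_mul_deriv_eq_zero (v := fun x => v x - g x)
    (hv.sub hg.integrable) (by
      intro φ h1 h2 h3
      have hφ' : tsupport (deriv φ) ⊆ Omega := (tsupport_deriv_subset).trans h3
      have hc : Continuous (deriv φ) := h1.continuous_deriv (by norm_cast)
      simp only [sub_mul]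
      rw [integral_sub (integrable_mul_test h.1 hc h2.deriv hφ').integrableOn
        (integrable_mul_test hg.hasWeakDeriv.1 hc h2.deriv hφ').integrableOn, h.2.2 φ h1 h2 h3,
        hg.hasWeakDeriv.2.2 φ h1 h2 h3]
      have : ∫ x in Omega, deriv g x * φ x = ∫ x in Omega, w x * φ x :=
        integral_congr_ae (by filter_upwards [hd] with x hx; rw [hx])
      rw [this]; ring)
  refine ⟨fun x => g x + k, AbsolutelyContinuousOnInterval.fun_add hg (ac_const k), ?_, ?_⟩
  · filter_upwards [hk] with x hx
    linarith
  · filter_upwards [hd] with x hx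
    rw [← hx, deriv_add_const]

theorem MemW1.exists_ac {p : ℝ≥0∞} {v : ℝ → ℝ} (hp : 1 ≤ p) (h : MemW1 p v) :
    ∃ g, AC g ∧ v =ᵐ[volOmega] g ∧ weakDeriv v =ᵐ[volOmega] deriv g :=
  h.2.1.exists_ac (h.1.integrable hp) (h.2.2.integrable hp)

theorem MemW1.of_ac {p : ℝ≥0∞} {g : ℝ → ℝ} (hg : AC g) (hd : MemLp (deriv g) p volOmega) :
    MemW1 p g := by
  refine ⟨?_, ?_, hd.ae_eq hg.weakDeriv_ae.symm⟩
  · obtain ⟨C, hC⟩ := AbsolutelyContinuousOnInterval.exists_bound hg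
    refine MemLp.of_bound hg.integrable.aestronglyMeasurable C ?_
    filter_upwards [ae_restrict_mem measurableSet_Ioo] with x hx
    exact hC x (by simpa using ⟨hx.1.le, hx.2.le⟩)
  · have h0 : ∃ w, HasWeakDeriv g w := ⟨_, hg.hasWeakDeriv⟩
    unfold weakDeriv
    rw [dif_pos h0]
    exact h0.choose_spec

/-! ### Meshes, step functions and the finite element space. -/

/-- The nodes are strictly increasing. -/
def IsMesh {N : ℕ} (X : Fin (N - 1) → ℝ) : Prop := ∀ j < N, node X j < node X (j + 1)

/-- The `j`-th open mesh cell. -/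
def cell {N : ℕ} (X : Fin (N - 1) → ℝ) (j : ℕ) : Set ℝ := Ioo (node X j) (node X (j + 1))

/-- The length of the `j`-th mesh cell. -/
def len {N : ℕ} (X : Fin (N - 1) → ℝ) (j : ℕ) : ℝ := node X (j + 1) - node X j

/-- The piecewise constant function with value `p j` on the `j`-th cell. -/
def step {N : ℕ} (X : Fin (N - 1) → ℝ) (p : ℕ → ℝ) (t : ℝ) : ℝ :=
  ∑ j ∈ Finset.range N, (cell X j).indicator (fun _ => p j) t

/-- The difference quotient of `v` over the `j`-th cell. -/
def slope {N : ℕ} (X : Fin (N - 1) → ℝ) (v : ℝ → ℝ) (j : ℕ) : ℝ :=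
  (v (node X (j + 1)) - v (node X j)) / len X j

/-- The element of `feSpace X` with the value `g j` at the `j`-th interior node. -/
def interp {N : ℕ} (X : Fin (N - 1) → ℝ) (g : ℕ → ℝ) : ℝ → ℝ :=
  ∑ i : Fin (N - 1), g (i + 1) • hat (node X i) (node X (i + 1)) (node X (i + 2))

section Mesh
variable {N : ℕ} {X : Fin (N - 1) → ℝ}

theorem measurableSet_cell (j : ℕ) : MeasurableSet (cell X j) := measurableSet_Ioo

theorem node_zero : node X 0 = 0 := by simp [node]

theorem node_last (hN : 1 ≤ N) : node X N = 1 := by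
  unfold node
  rw [if_neg (by omega), dif_neg (by omega)]

theorem IsMesh.node_le (hX : IsMesh X) {i j : ℕ} (hij : i ≤ j) (hj : j ≤ N) :
    node X i ≤ node X j := by
  induction j, hij using Nat.le_induction with
  | base => rfl
  | succ k _ ih => exact (ih (by omega)).trans (hX k (by omega)).le

theorem IsMesh.len_pos (hX : IsMesh X) {j : ℕ} (hj : j < N) : 0 < len X j :=
  sub_pos.2 (hX j hj)

theorem IsMesh.node_mem (hX : IsMesh X) {j : ℕ} (hj : j ≤ N) (hN : 1 ≤ N) :
    node X j ∈ Icc (0 : ℝ) 1 := by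
  constructor
  · rw [← node_zero (X := X)]; exact hX.node_le (Nat.zero_le _) hj
  · rw [← node_last (X := X) hN]; exact hX.node_le hj le_rfl

theorem IsMesh.cell_subset (hX : IsMesh X) {j : ℕ} (hj : j < N) : cell X j ⊆ Omega := by
  have h1 := (hX.node_mem hj.le (by omega)).1
  have h2 := (hX.node_mem (j := j + 1) hj (by omega)).2
  exact fun t ht => ⟨h1.trans_lt ht.1, ht.2.trans_le h2⟩

theorem IsMesh.cell_unique (hX : IsMesh X) {i j : ℕ} (hi : i < N) (hj : j < N) {t : ℝ}
    (h : t ∈ cell X i) (h' : t ∈ cell X j) : i = j := by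
  rcases lt_trichotomy i j with hij | hij | hij
  · have := hX.node_le (i := i + 1) hij hj.le
    exact absurd (h.2.trans_le this) (not_lt.2 h'.1.le)
  · exact hij
  · have := hX.node_le (i := j + 1) hij hi.le
    exact absurd (h'.2.trans_le this) (not_lt.2 h.1.le)

theorem sum_len (hN : 1 ≤ N) : ∑ j ∈ Finset.range N, len X j = 1 := by
  unfold len
  rw [Finset.sum_range_sub, node_zero, node_last hN, sub_zero]

theorem ae_mem_cell (hN : 1 ≤ N) :
    ∀ᵐ t ∂volOmega, ∃ j < N, t ∈ cell X j := by
  have h : ∀ᵐ t ∂volOmega, t ∉ (Finset.range (N + 1)).image (node X) :=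
    ae_restrict_of_ae (measure_eq_zero_iff_ae_notMem.1 ((Finset.finite_toSet _).measure_zero _))
  filter_upwards [h, ae_restrict_mem measurableSet_Ioo] with t ht ht'
  -- Induction finds the first node to the right of `t`; equality with a node is excluded off a
  -- finite, hence null, set.
  have key : ∀ n, n ≤ N → t < node X n → ∃ j < N, t ∈ cell X j := by
    intro n
    induction n with
    | zero => intro _ h; rw [node_zero] at h; exact absurd h (not_lt.2 ht'.1.le)
    | succ n ih =>
      intro hn h
      rcases lt_trichotomy t (node X n) with h' | h' | h'
      · exact ih (by omega) h'
      · exact absurd (Finset.mem_image.2 ⟨n, Finset.mem_range.2 (by omega), h'.symm⟩) ht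
      · exact ⟨n, by omega, h', h⟩
  exact key N le_rfl (by rw [node_last hN]; exact ht'.2)

theorem IsMesh.step_eq (hX : IsMesh X) (p : ℕ → ℝ) {j : ℕ} (hj : j < N) {t : ℝ}
    (ht : t ∈ cell X j) : step X p t = p j := by
  unfold step
  rw [Finset.sum_eq_single j]
  · exact indicator_of_mem ht _
  · intro i hi hij
    apply indicator_of_notMem
    exact fun h => hij (hX.cell_unique (Finset.mem_range.1 hi) hj h ht)
  · intro h
    exact absurd (Finset.mem_range.2 hj) h

theorem measurable_step (p : ℕ → ℝ) : Measurable (step X p) :=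
  Finset.measurable_fun_sum _ fun _ _ => measurable_const.indicator measurableSet_Ioo

theorem abs_step_le (p : ℕ → ℝ) (t : ℝ) : |step X p t| ≤ ∑ j ∈ Finset.range N, |p j| := by
  refine (Finset.abs_sum_le_sum_abs _ _).trans (Finset.sum_le_sum fun j _ => ?_)
  by_cases h : t ∈ cell X j <;> simp [h]

theorem integrable_step_mul (p : ℕ → ℝ) {g : ℝ → ℝ} (hg : Integrable g volOmega) :
    Integrable (fun t => step X p t * g t) volOmega :=
  hg.bdd_mul (measurable_step p).aestronglyMeasurable
    (Filter.Eventually.of_forall fun t => abs_step_le p t)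

theorem integrable_step (p : ℕ → ℝ) : Integrable (step X p) volOmega := by
  simpa using integrable_step_mul (X := X) p (integrable_const (1 : ℝ) (μ := volOmega))

theorem memLp_step (p : ℕ → ℝ) (q : ℝ≥0∞) : MemLp (step X p) q volOmega :=
  MemLp.of_bound (measurable_step p).aestronglyMeasurable _
    (Filter.Eventually.of_forall fun t => abs_step_le p t)

theorem IsMesh.setIntegral_eq_sum (hX : IsMesh X) (hN : 1 ≤ N) {g : ℝ → ℝ}
    (hg : Integrable g volOmega) :
    ∫ t in Omega, g t = ∑ j ∈ Finset.range N, ∫ t in cell X j, g t := by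
  have h : g =ᵐ[volOmega] fun t => ∑ j ∈ Finset.range N, (cell X j).indicator g t := by
    filter_upwards [ae_mem_cell (X := X) hN] with t ⟨j, hj, ht⟩
    rw [Finset.sum_eq_single j]
    · exact (indicator_of_mem ht _).symm
    · intro i hi hij
      apply indicator_of_notMem
      exact fun h => hij (hX.cell_unique (Finset.mem_range.1 hi) hj h ht)
    · intro h
      exact absurd (Finset.mem_range.2 hj) h
  rw [integral_congr_ae h, integral_finsetSum _ fun j _ =>
    hg.indicator (measurableSet_cell j)]
  refine Finset.sum_congr rfl fun j hj => ?_
  rw [setIntegral_indicator (measurableSet_cell j), inter_eq_self_of_subset_right]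
  exact hX.cell_subset (Finset.mem_range.1 hj)

theorem IsMesh.integral_step_mul (hX : IsMesh X) (hN : 1 ≤ N) (p : ℕ → ℝ) {g : ℝ → ℝ}
    (hg : Integrable g volOmega) :
    ∫ t in Omega, step X p t * g t = ∑ j ∈ Finset.range N, p j * ∫ t in cell X j, g t := by
  rw [hX.setIntegral_eq_sum hN (integrable_step_mul p hg)]
  refine Finset.sum_congr rfl fun j hj => ?_
  rw [← integral_const_mul]
  exact setIntegral_congr_fun measurableSet_Ioo fun t ht => by
    simp only [hX.step_eq p (Finset.mem_range.1 hj) ht]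

theorem IsMesh.integral_step (hX : IsMesh X) (hN : 1 ≤ N) (p : ℕ → ℝ) :
    ∫ t in Omega, step X p t = ∑ j ∈ Finset.range N, p j * len X j := by
  have := hX.integral_step_mul hN p (integrable_const (1 : ℝ) (μ := volOmega))
  simp only [mul_one] at this
  rw [this]
  refine Finset.sum_congr rfl fun j hj => ?_
  have := hX.len_pos (Finset.mem_range.1 hj)
  unfold len at *
  unfold cell
  simp [this.le]

theorem IsMesh.step_mul_step (hX : IsMesh X) (hN : 1 ≤ N) (p q : ℕ → ℝ) :
    ∀ᵐ t ∂volOmega, step X p t * step X q t = step X (fun j => p j * q j) t := by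
  filter_upwards [ae_mem_cell (X := X) hN] with t ⟨j, hj, ht⟩
  simp only [hX.step_eq _ hj ht]

theorem IsMesh.abs_step (hX : IsMesh X) (hN : 1 ≤ N) (p : ℕ → ℝ) :
    ∀ᵐ t ∂volOmega, |step X p t| = step X (fun j => |p j|) t := by
  filter_upwards [ae_mem_cell (X := X) hN] with t ⟨j, hj, ht⟩
  simp only [hX.step_eq _ hj ht]

theorem hat_eq_zero_of_le {l m r t : ℝ} (h1 : l < m) (ht : t ≤ l) : hat l m r t = 0 := by
  unfold hat
  apply max_eq_left
  exact (min_le_left _ _).trans (div_nonpos_of_nonpos_of_nonneg (by linarith) (by linarith))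

theorem hat_eq_zero_of_ge {l m r t : ℝ} (h1 : m < r) (ht : r ≤ t) : hat l m r t = 0 := by
  unfold hat
  apply max_eq_left
  exact (min_le_right _ _).trans (div_nonpos_of_nonpos_of_nonneg (by linarith) (by linarith))

theorem hat_eq_left {l m r t : ℝ} (h1 : l < m) (h2 : m < r) (ht : t ∈ Icc l m) :
    hat l m r t = (t - l) / (m - l) := by
  obtain ⟨ht1, ht2⟩ := ht
  have h3 : (t - l) / (m - l) ≤ 1 := (div_le_one (by linarith)).2 (by linarith)
  have h4 : 1 ≤ (r - t) / (r - m) := (one_le_div (by linarith)).2 (by linarith)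
  have h5 : 0 ≤ (t - l) / (m - l) := div_nonneg (by linarith) (by linarith)
  unfold hat
  rw [min_eq_left (h3.trans h4), max_eq_right h5]

theorem hat_eq_right {l m r t : ℝ} (h1 : l < m) (h2 : m < r) (ht : t ∈ Icc m r) :
    hat l m r t = (r - t) / (r - m) := by
  obtain ⟨ht1, ht2⟩ := ht
  have h3 : (r - t) / (r - m) ≤ 1 := (div_le_one (by linarith)).2 (by linarith)
  have h4 : 1 ≤ (t - l) / (m - l) := (one_le_div (by linarith)).2 (by linarith)
  have h5 : 0 ≤ (r - t) / (r - m) := div_nonneg (by linarith) (by linarith)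
  unfold hat
  rw [min_eq_right (h3.trans h4), max_eq_right h5]


end Mesh

theorem lipschitzWith_hat (l m r : ℝ) : ∃ K, LipschitzWith K (hat l m r) := by
  have h1 : LipschitzWith ‖(m - l)⁻¹‖₊ fun t => (t - l) / (m - l) :=
    LipschitzWith.of_dist_le_mul fun x y => by
      rw [Real.dist_eq, Real.dist_eq, ← sub_div, div_eq_mul_inv, abs_mul, mul_comm, coe_nnnorm,
        Real.norm_eq_abs, sub_sub_sub_cancel_right]
  have h2 : LipschitzWith ‖(r - m)⁻¹‖₊ fun t => (r - t) / (r - m) :=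
    LipschitzWith.of_dist_le_mul fun x y => by
      rw [Real.dist_eq, Real.dist_eq, ← sub_div, div_eq_mul_inv, abs_mul, mul_comm, coe_nnnorm,
        Real.norm_eq_abs, sub_sub_sub_cancel_left, abs_sub_comm]
  exact ⟨_, (h1.min h2).const_max 0⟩

theorem ac_hat (l m r : ℝ) : AC (hat l m r) :=
  ((lipschitzWith_hat l m r).choose_spec.lipschitzOnWith).absolutelyContinuousOnInterval

section Mesh
variable {N : ℕ} {X : Fin (N - 1) → ℝ}

theorem IsMesh.hat_node (hX : IsMesh X) (i : Fin (N - 1)) {j : ℕ} (hj : j ≤ N) :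
    hat (node X i) (node X (i + 1)) (node X (i + 2)) (node X j) = if j = i + 1 then 1 else 0 := by
  have hi := i.2
  have h1 := hX i (by omega)
  have h2 := hX (i + 1) (by omega)
  rcases lt_trichotomy j (i + 1) with h | h | h
  · rw [if_neg h.ne, hat_eq_zero_of_le h1 (hX.node_le (by omega) (by omega))]
  · rw [if_pos h, h, hat_eq_left h1 h2 (right_mem_Icc.2 h1.le), div_self (by linarith)]
  · rw [if_neg h.ne', hat_eq_zero_of_ge h2 (hX.node_le (by omega) hj)]

theorem IsMesh.hat_affine (hX : IsMesh X) (i : Fin (N - 1)) {j : ℕ} (hj : j < N) :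
    ∃ p q : ℝ, ∀ t ∈ Icc (node X j) (node X (j + 1)),
      hat (node X i) (node X (i + 1)) (node X (i + 2)) t = p * t + q := by
  have hi := i.2
  have h1 := hX i (by omega)
  have h2 := hX (i + 1) (by omega)
  rcases lt_trichotomy j i with h | h | h
  · refine ⟨0, 0, fun t ht => ?_⟩
    rw [hat_eq_zero_of_le h1 (ht.2.trans (hX.node_le (by omega) (by omega)))]; ring
  · subst h
    refine ⟨1 / (node X (i + 1) - node X i), -node X i / (node X (i + 1) - node X i),
      fun t ht => ?_⟩
    rw [hat_eq_left h1 h2 ht]; ring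
  · rcases (show j = i + 1 ∨ i + 2 ≤ j by omega) with h | h
    · subst h
      refine ⟨-1 / (node X (i + 2) - node X (i + 1)),
        node X (i + 2) / (node X (i + 2) - node X (i + 1)), fun t ht => ?_⟩
      rw [hat_eq_right h1 h2 ht]; ring
    · refine ⟨0, 0, fun t ht => ?_⟩
      rw [hat_eq_zero_of_ge h2 ((hX.node_le h hj.le).trans ht.1)]; ring

theorem feSpace_ac {v : ℝ → ℝ} (hv : v ∈ feSpace X) : AC v := by
  induction hv using Submodule.span_induction with
  | mem x h => obtain ⟨i, rfl⟩ := h; exact ac_hat _ _ _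
  | zero => exact ac_const 0
  | add x y _ _ hx hy => exact AbsolutelyContinuousOnInterval.add hx hy
  | smul k x _ hx => exact AbsolutelyContinuousOnInterval.const_smul k hx

theorem IsMesh.feSpace_affine (hX : IsMesh X) {v : ℝ → ℝ} (hv : v ∈ feSpace X) {j : ℕ}
    (hj : j < N) :
    ∃ p q : ℝ, ∀ t ∈ Icc (node X j) (node X (j + 1)), v t = p * t + q := by
  induction hv using Submodule.span_induction with
  | mem x h => obtain ⟨i, rfl⟩ := h; exact hX.hat_affine i hj
  | zero => exact ⟨0, 0, fun t _ => by simp⟩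
  | add x y _ _ hx hy =>
    obtain ⟨p, q, h⟩ := hx
    obtain ⟨p', q', h'⟩ := hy
    exact ⟨p + p', q + q', fun t ht => by rw [Pi.add_apply, h t ht, h' t ht]; ring⟩
  | smul k x _ hx =>
    obtain ⟨p, q, h⟩ := hx
    exact ⟨k * p, k * q, fun t ht => by rw [Pi.smul_apply, h t ht, smul_eq_mul]; ring⟩

theorem IsMesh.feSpace_zero (hX : IsMesh X) {v : ℝ → ℝ} (hv : v ∈ feSpace X) : v 0 = 0 := by
  induction hv using Submodule.span_induction with
  | mem x h =>
    obtain ⟨i, rfl⟩ := h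
    have := hX.hat_node i (Nat.zero_le N)
    rw [node_zero] at this
    simpa using this
  | zero => rfl
  | add x y _ _ hx hy => simp [hx, hy]
  | smul k x _ hx => simp [hx]

theorem IsMesh.feSpace_one (hX : IsMesh X) (hN : 1 ≤ N) {v : ℝ → ℝ} (hv : v ∈ feSpace X) :
    v 1 = 0 := by
  induction hv using Submodule.span_induction with
  | mem x h =>
    obtain ⟨i, rfl⟩ := h
    have := hX.hat_node i le_rfl
    have hi := i.2
    rwa [node_last hN, if_neg (by omega)] at this
  | zero => rfl
  | add x y _ _ hx hy => simp [hx, hy]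
  | smul k x _ hx => simp [hx]

theorem IsMesh.feSpace_eq (hX : IsMesh X) {v : ℝ → ℝ} (hv : v ∈ feSpace X) {j : ℕ}
    (hj : j < N) {t : ℝ} (ht : t ∈ Icc (node X j) (node X (j + 1))) :
    v t = v (node X j) + slope X v j * (t - node X j) := by
  obtain ⟨p, q, h⟩ := hX.feSpace_affine hv hj
  have h1 := hX j hj
  have h2 := sub_ne_zero.2 h1.ne'
  unfold slope len
  rw [h t ht, h _ (left_mem_Icc.2 h1.le), h _ (right_mem_Icc.2 h1.le)]
  field_simp
  ring

theorem IsMesh.deriv_feSpace_of_mem (hX : IsMesh X) {v : ℝ → ℝ} (hv : v ∈ feSpace X) {j : ℕ}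
    (hj : j < N) {t : ℝ} (ht : t ∈ cell X j) : deriv v t = slope X v j := by
  have h : v =ᶠ[nhds t] fun t => v (node X j) + slope X v j * (t - node X j) := by
    filter_upwards [isOpen_Ioo.mem_nhds ht] with s hs
    exact hX.feSpace_eq hv hj (Ioo_subset_Icc_self hs)
  have h2 : HasDerivAt (fun t => v (node X j) + slope X v j * (t - node X j))
      (slope X v j * 1) t := (((hasDerivAt_id t).sub_const _).const_mul _).const_add _
  rw [h.deriv_eq, h2.deriv, mul_one]

theorem IsMesh.deriv_feSpace (hX : IsMesh X) (hN : 1 ≤ N) {v : ℝ → ℝ} (hv : v ∈ feSpace X) :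
    deriv v =ᵐ[volOmega] step X (slope X v) := by
  filter_upwards [ae_mem_cell (X := X) hN] with t ⟨j, hj, ht⟩
  rw [hX.deriv_feSpace_of_mem hv hj ht, hX.step_eq _ hj ht]

theorem IsMesh.weakDeriv_feSpace (hX : IsMesh X) (hN : 1 ≤ N) {v : ℝ → ℝ} (hv : v ∈ feSpace X) :
    weakDeriv v =ᵐ[volOmega] step X (slope X v) :=
  (feSpace_ac hv).weakDeriv_ae.trans (hX.deriv_feSpace hN hv)

/-- Conformity of the method: it allows finite element functions as test functions in the continuous
problem, which is Galerkin orthogonality. -/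
theorem IsMesh.memH10_feSpace (hX : IsMesh X) (hN : 1 ≤ N) {v : ℝ → ℝ} (hv : v ∈ feSpace X) :
    MemH10 v :=
  ⟨MemW1.of_ac (feSpace_ac hv) ((memLp_step _ 2).ae_eq (hX.deriv_feSpace hN hv).symm),
    v, (feSpace_ac hv).continuousOn_Icc, Filter.EventuallyEq.rfl, hX.feSpace_zero hv,
    hX.feSpace_one hN hv⟩

theorem interp_mem (g : ℕ → ℝ) : interp X g ∈ feSpace X :=
  Submodule.sum_mem _ fun i _ => Submodule.smul_mem _ _ (Submodule.subset_span ⟨i, rfl⟩)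

/-- There are no hats at the two end nodes, so the data must vanish there. -/
theorem IsMesh.interp_node (hX : IsMesh X) (hN : 1 ≤ N) {g : ℕ → ℝ} (h0 : g 0 = 0)
    (h1 : g N = 0) {j : ℕ} (hj : j ≤ N) : interp X g (node X j) = g j := by
  unfold interp
  rw [Finset.sum_apply]
  simp only [Pi.smul_apply, smul_eq_mul, hX.hat_node _ hj]
  by_cases hj0 : j = 0
  · subst hj0; simp [h0]
  by_cases hjN : j = N
  · subst hjN
    rw [h1]
    apply Finset.sum_eq_zero
    intro i _
    have := i.2
    rw [if_neg (by omega), mul_zero]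
  · rw [Finset.sum_eq_single ⟨j - 1, by omega⟩]
    · simp [show j - 1 + 1 = j by omega]
    · intro i _ hi
      rw [if_neg, mul_zero]
      intro h
      exact hi (Fin.ext (by simp; omega))
    · simp

end Mesh

/-! ### Bounded coefficients, coercivity and stability of the discrete solution. -/

theorem memLp_top_mul {f g : ℝ → ℝ} (hf : MemLp f ⊤ volOmega) (hg : MemLp g ⊤ volOmega) :
    MemLp (fun x => f x * g x) ⊤ volOmega := hg.mul hf

theorem exists_ae_bound {f : ℝ → ℝ} (hf : MemLp f ⊤ volOmega) :
    ∃ K : ℝ, 0 ≤ K ∧ ∀ᵐ x ∂volOmega, |f x| ≤ K := by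
  refine ⟨(eLpNorm f ⊤ volOmega).toReal, ENNReal.toReal_nonneg, ?_⟩
  have h := ae_le_eLpNormEssSup (f := f) (μ := volOmega)
  rw [← eLpNorm_exponent_top] at h
  filter_upwards [h] with x hx
  rw [← Real.norm_eq_abs, ← toReal_enorm]
  exact ENNReal.toReal_mono hf.2.ne hx

theorem integrable_memLp_top_mul {f g : ℝ → ℝ} (hf : MemLp f ⊤ volOmega)
    (hg : Integrable g volOmega) : Integrable (fun x => f x * g x) volOmega := by
  obtain ⟨K, _, hK⟩ := exists_ae_bound hf
  exact hg.bdd_mul hf.1 hK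

theorem memLp_top_of_continuousOn {g : ℝ → ℝ} (hg : ContinuousOn g (Icc 0 1)) :
    MemLp g ⊤ volOmega := by
  obtain ⟨C, hC⟩ := isCompact_Icc.exists_bound_of_continuousOn hg
  refine MemLp.of_bound (integrable_of_continuousOn_Icc hg).aestronglyMeasurable C ?_
  filter_upwards [ae_restrict_mem measurableSet_Ioo] with x hx
  exact hC x (Ioo_subset_Icc_self hx)

theorem AC.memLp_top {g : ℝ → ℝ} (hg : AC g) : MemLp g ⊤ volOmega :=
  memLp_top_of_continuousOn hg.continuousOn_Icc

theorem AC.sub_eq_integral {g : ℝ → ℝ} (hg : AC g) {s t : ℝ} (hs : 0 ≤ s) (hst : s ≤ t)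
    (ht : t ≤ 1) : g t - g s = ∫ x in Ioo s t, deriv g x := by
  have h : AbsolutelyContinuousOnInterval g s t := AbsolutelyContinuousOnInterval.mono hg (by
    rw [uIcc_of_le hst, uIcc_of_le zero_le_one]; exact Icc_subset_Icc hs ht)
  rw [← AbsolutelyContinuousOnInterval.integral_deriv_eq_sub h,
    intervalIntegral.integral_of_le hst, integral_Ioc_eq_integral_Ioo]

theorem AC.abs_sub_le {g : ℝ → ℝ} (hg : AC g) {l r : ℝ} (hl : 0 ≤ l) (hr : r ≤ 1) {s t : ℝ}
    (hs : s ∈ Icc l r) (ht : t ∈ Icc l r) : |g t - g s| ≤ ∫ x in Ioo l r, |deriv g x| := by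
  wlog hst : s ≤ t generalizing s t
  · rw [abs_sub_comm]
    exact this ht hs (le_of_not_ge hst)
  rw [hg.sub_eq_integral (hl.trans hs.1) hst (ht.2.trans hr)]
  refine (abs_integral_le_integral_abs).trans ?_
  refine setIntegral_mono_set ?_ (Filter.Eventually.of_forall fun _ => abs_nonneg _)
    (Ioo_subset_Ioo hs.1 ht.2).eventuallyLE
  have h2 : IntegrableOn (fun x => |deriv g x|) Omega := hg.integrable_deriv.abs
  exact h2.mono_set (Ioo_subset_Ioo hl hr)

theorem AC.abs_le {g : ℝ → ℝ} (hg : AC g) (h0 : g 0 = 0) {t : ℝ} (ht : t ∈ Icc (0 : ℝ) 1) :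
    |g t| ≤ ∫ x in Omega, |deriv g x| := by
  simpa [h0] using hg.abs_sub_le le_rfl le_rfl (s := 0) (by simp) ht

/-- The total variation on `[0,1]` of the piecewise linear function through the nodal values
of `v`. -/
def tv {N : ℕ} (X : Fin (N - 1) → ℝ) (v : ℝ → ℝ) : ℝ :=
  ∑ j ∈ Finset.range N, |slope X v j| * len X j

/-- The `H¹` seminorm of the piecewise linear function through the nodal values of `v`. -/
def seminorm {N : ℕ} (X : Fin (N - 1) → ℝ) (v : ℝ → ℝ) : ℝ :=
  √(∑ j ∈ Finset.range N, slope X v j ^ 2 * len X j)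

section Mesh
variable {N : ℕ} {X : Fin (N - 1) → ℝ}

theorem seminorm_nonneg (v : ℝ → ℝ) : 0 ≤ seminorm X v := Real.sqrt_nonneg _

theorem IsMesh.seminorm_sq (hX : IsMesh X) (v : ℝ → ℝ) :
    seminorm X v ^ 2 = ∑ j ∈ Finset.range N, slope X v j ^ 2 * len X j :=
  Real.sq_sqrt (Finset.sum_nonneg fun _ hj =>
    mul_nonneg (sq_nonneg _) (hX.len_pos (Finset.mem_range.1 hj)).le)

theorem IsMesh.sum_mul_le (hX : IsMesh X) (p q : ℕ → ℝ) :
    ∑ j ∈ Finset.range N, |p j| * |q j| * len X j ≤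
      √(∑ j ∈ Finset.range N, p j ^ 2 * len X j) * √(∑ j ∈ Finset.range N, q j ^ 2 * len X j) := by
  have h := Real.sum_mul_le_sqrt_mul_sqrt (Finset.range N) (fun j => |p j| * √(len X j))
    (fun j => |q j| * √(len X j))
  have e : ∀ j ∈ Finset.range N, √(len X j) ^ 2 = len X j := fun _ hj =>
    Real.sq_sqrt (hX.len_pos (Finset.mem_range.1 hj)).le
  refine le_trans (le_of_eq (Finset.sum_congr rfl fun j hj => ?_)) (h.trans (le_of_eq ?_))
  · linear_combination (-(|p j| * |q j|)) * e j hj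
  · congr 2 <;> refine Finset.sum_congr rfl fun j hj => ?_ <;> rw [mul_pow, e j hj, sq_abs]

/-- Cauchy–Schwarz against the constant `1` on an interval of length one. With `IsMesh.abs_le_tv` it
serves as the Poincaré inequality, with constant `1`. -/
theorem IsMesh.tv_le_seminorm (hX : IsMesh X) (hN : 1 ≤ N) (v : ℝ → ℝ) :
    tv X v ≤ seminorm X v := by
  have := hX.sum_mul_le (slope X v) (fun _ => 1)
  unfold tv seminorm
  simpa [sum_len hN] using this

theorem IsMesh.tv_nonneg (hX : IsMesh X) (v : ℝ → ℝ) : 0 ≤ tv X v :=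
  Finset.sum_nonneg fun _ hj => mul_nonneg (abs_nonneg _) (hX.len_pos (Finset.mem_range.1 hj)).le

theorem IsMesh.integral_abs_slope (hX : IsMesh X) (hN : 1 ≤ N) (v : ℝ → ℝ) :
    ∫ t in Omega, |step X (slope X v) t| = tv X v := by
  rw [integral_congr_ae (hX.abs_step hN _), hX.integral_step hN]
  rfl

theorem IsMesh.integral_sq_slope (hX : IsMesh X) (hN : 1 ≤ N) (v : ℝ → ℝ) :
    ∫ t in Omega, step X (slope X v) t ^ 2 = seminorm X v ^ 2 := by
  simp only [sq (step _ _ _)]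
  rw [integral_congr_ae (hX.step_mul_step hN _ _), hX.integral_step hN, hX.seminorm_sq]
  simp only [sq]

theorem IsMesh.abs_le_tv (hX : IsMesh X) (hN : 1 ≤ N) {v : ℝ → ℝ} (hv : v ∈ feSpace X) {t : ℝ}
    (ht : t ∈ Icc (0 : ℝ) 1) : |v t| ≤ tv X v := by
  refine ((feSpace_ac hv).abs_le (hX.feSpace_zero hv) ht).trans (le_of_eq ?_)
  rw [← hX.integral_abs_slope hN]
  refine integral_congr_ae ?_
  filter_upwards [hX.deriv_feSpace hN hv] with x hx
  rw [hx]

theorem IsMesh.memLp_weakDeriv (hX : IsMesh X) (hN : 1 ≤ N) {v : ℝ → ℝ} (hv : v ∈ feSpace X) :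
    MemLp (weakDeriv v) ⊤ volOmega :=
  (memLp_step _ ⊤).ae_eq (hX.weakDeriv_feSpace hN hv).symm

theorem integrable_bilin {a b c v e : ℝ → ℝ} (ha : MemLp a ⊤ volOmega) (hb : MemLp b ⊤ volOmega)
    (hc : MemLp c ⊤ volOmega) (hv : Integrable v volOmega)
    (hv' : Integrable (weakDeriv v) volOmega) (he : MemLp e ⊤ volOmega)
    (he' : MemLp (weakDeriv e) ⊤ volOmega) :
    Integrable (fun x => a x * weakDeriv v x * weakDeriv e x + b x * weakDeriv v x * e x
      + c x * v x * e x) volOmega := by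
  have h1 := integrable_memLp_top_mul (memLp_top_mul ha he') hv'
  have h2 := integrable_memLp_top_mul (memLp_top_mul hb he) hv'
  have h3 := integrable_memLp_top_mul (memLp_top_mul hc he) hv
  refine ((h1.add h2).add h3).congr (Filter.Eventually.of_forall fun x => ?_)
  simp only [Pi.add_apply]
  ring

theorem weakDeriv_sub {v w : ℝ → ℝ} (hv : AC v) (hw : AC w) :
    weakDeriv (v - w) =ᵐ[volOmega] fun x => weakDeriv v x - weakDeriv w x := by
  have h : AC (v - w) := AbsolutelyContinuousOnInterval.sub hv hw
  filter_upwards [h.weakDeriv_ae, hv.weakDeriv_ae, hw.weakDeriv_ae, hv.ae_differentiableAt,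
    hw.ae_differentiableAt] with x h1 h2 h3 h4 h5
  rw [h1, h2, h3, deriv_sub h4 h5]

theorem AC.integrable_weakDeriv {v : ℝ → ℝ} (hv : AC v) : Integrable (weakDeriv v) volOmega :=
  hv.integrable_deriv.congr hv.weakDeriv_ae.symm

theorem bilin_sub_left {a b c v w e : ℝ → ℝ} (ha : MemLp a ⊤ volOmega) (hb : MemLp b ⊤ volOmega)
    (hc : MemLp c ⊤ volOmega) (hv : AC v) (hw : AC w) (he : MemLp e ⊤ volOmega)
    (he' : MemLp (weakDeriv e) ⊤ volOmega) :
    bilin a b c (v - w) e = bilin a b c v e - bilin a b c w e := by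
  unfold bilin
  rw [← integral_sub (integrable_bilin ha hb hc hv.integrable hv.integrable_weakDeriv he he')
    (integrable_bilin ha hb hc hw.integrable hw.integrable_weakDeriv he he')]
  refine integral_congr_ae ?_
  filter_upwards [weakDeriv_sub hv hw] with x hx
  rw [hx, Pi.sub_apply]
  ring

theorem bilin_congr_left {a b c v w e : ℝ → ℝ} (h : v =ᵐ[volOmega] w)
    (h' : weakDeriv v =ᵐ[volOmega] weakDeriv w) : bilin a b c v e = bilin a b c w e := by
  refine integral_congr_ae ?_
  filter_upwards [h, h'] with x h1 h2
  rw [h1, h2]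

theorem integrable_energySq {a b c v : ℝ → ℝ} (ha : MemLp a ⊤ volOmega) (hb : MemW1 ⊤ b)
    (hc : MemLp c ⊤ volOmega) (hv : AC v) (hv' : MemLp (weakDeriv v) ⊤ volOmega) :
    Integrable (fun x => a x * weakDeriv v x ^ 2 + (c x - 1 / 2 * weakDeriv b x) * v x ^ 2)
      volOmega := by
  have h1 := memLp_top_mul ha (memLp_top_mul hv' hv')
  have h2 := memLp_top_mul (hc.sub (hb.2.2.const_mul (1 / 2))) (memLp_top_mul hv.memLp_top
    hv.memLp_top)
  refine ((h1.add h2).integrable le_top).congr (Filter.Eventually.of_forall fun x => ?_)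
  simp only [Pi.add_apply, Pi.sub_apply]
  ring

/-- Twice the difference of the integrands is `2 b v' v + b' v² = (b v²)'`, whose integral vanishes
by the boundary values. -/
theorem bilin_self {a b c v : ℝ → ℝ} (ha : MemLp a ⊤ volOmega) (hb : MemW1 ⊤ b)
    (hc : MemLp c ⊤ volOmega) (hv : AC v) (hv' : MemLp (weakDeriv v) ⊤ volOmega)
    (h0 : v 0 = 0) (h1 : v 1 = 0) : bilin a b c v v = energySq a b c v := by
  obtain ⟨β, hβ, hbβ, hb'⟩ := hb.exists_ac le_top
  have key := AbsolutelyContinuousOnInterval.integral_deriv_mul_eq_sub hβ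
    (AbsolutelyContinuousOnInterval.fun_mul hv hv)
  rw [intervalIntegral_eq_integral_Omega, h0, h1] at key
  rw [← sub_eq_zero]
  unfold bilin energySq
  rw [← integral_sub (integrable_bilin ha hb.1 hc hv.integrable (hv'.integrable le_top)
    hv.memLp_top hv') (integrable_energySq ha hb hc hv hv')]
  rw [← mul_right_inj' (two_ne_zero' ℝ), ← integral_const_mul]
  refine Eq.trans (integral_congr_ae ?_) (key.trans (by ring))
  filter_upwards [hbβ, hb', hv.weakDeriv_ae, hv.ae_differentiableAt] with x e1 e2 e3 e4
  rw [deriv_fun_mul e4 e4, e1, e2, e3]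
  ring

theorem IsMesh.coercive (hX : IsMesh X) (hN : 1 ≤ N) {a b c v : ℝ → ℝ} {a₀ : ℝ}
    (ha : MemLp a ⊤ volOmega) (hb : MemW1 ⊤ b) (hc : MemLp c ⊤ volOmega)
    (haa₀ : ∀ᵐ x ∂volOmega, a₀ ≤ a x)
    (hcb : ∀ᵐ x ∂volOmega, 0 ≤ c x - 1 / 2 * weakDeriv b x) (hv : v ∈ feSpace X) :
    a₀ * seminorm X v ^ 2 ≤ bilin a b c v v := by
  have hv1 := feSpace_ac hv
  have hv2 := hX.memLp_weakDeriv hN hv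
  rw [bilin_self ha hb hc hv1 hv2 (hX.feSpace_zero hv) (hX.feSpace_one hN hv),
    ← hX.integral_sq_slope hN, ← integral_const_mul]
  refine integral_mono_ae ?_ (integrable_energySq ha hb hc hv1 hv2) ?_
  · have := ((memLp_top_mul (memLp_step (X := X) (slope X v) ⊤) (memLp_step (X := X) (slope X v) ⊤)).integrable
      le_top).const_mul a₀
    simpa only [sq] using this
  · filter_upwards [haa₀, hcb, hX.weakDeriv_feSpace hN hv] with x h1 h2 h3
    rw [h3]
    have := mul_nonneg h2 (sq_nonneg (v x))
    have := mul_le_mul_of_nonneg_right h1 (sq_nonneg (step X (slope X v) x))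
    linarith

/-- Cancels one power of the seminorm after a coercivity estimate, including the case `D = 0`. -/
theorem le_of_mul_sq_le {α D K : ℝ} (hD : 0 ≤ D) (hK : 0 ≤ K) (h : α * D ^ 2 ≤ K * D) :
    α * D ≤ K := by
  rcases hD.eq_or_lt with h0 | h0
  · rw [← h0, mul_zero]; exact hK
  · exact le_of_mul_le_mul_right (by linarith [sq D]) h0

theorem volOmega_real : volOmega.real univ = 1 := by simp [Measure.real]

theorem abs_pairing_le {f v : ℝ → ℝ} {F K : ℝ} (hF : ∀ᵐ x ∂volOmega, |f x| ≤ F) (hF0 : 0 ≤ F)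
    (hK : ∀ x ∈ Icc (0 : ℝ) 1, |v x| ≤ K) : |pairing f v| ≤ F * K := by
  have h : ∀ᵐ x ∂volOmega, ‖f x * v x‖ ≤ F * K := by
    filter_upwards [hF, ae_restrict_mem measurableSet_Ioo] with x hx hx'
    rw [norm_mul]
    exact mul_le_mul hx (hK x (Ioo_subset_Icc_self hx')) (norm_nonneg _) hF0
  have := norm_integral_le_of_norm_le_const h
  rwa [volOmega_real, mul_one] at this

/-- The discrete solution is tested with itself, and its sup norm is bounded by its own seminorm. -/
theorem IsMesh.seminorm_solution_le (hX : IsMesh X) (hN : 1 ≤ N) {a b c f w : ℝ → ℝ} {a₀ F : ℝ}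
    (ha : MemLp a ⊤ volOmega) (hb : MemW1 ⊤ b) (hc : MemLp c ⊤ volOmega)
    (haa₀ : ∀ᵐ x ∂volOmega, a₀ ≤ a x)
    (hcb : ∀ᵐ x ∂volOmega, 0 ≤ c x - 1 / 2 * weakDeriv b x)
    (hF : ∀ᵐ x ∂volOmega, |f x| ≤ F) (hF0 : 0 ≤ F) (hw : IsFESolution a b c f X w) :
    a₀ * seminorm X w ≤ F := by
  refine le_of_mul_sq_le (seminorm_nonneg w) hF0 ?_
  refine (hX.coercive hN ha hb hc haa₀ hcb hw.1).trans ?_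
  rw [hw.2 w hw.1]
  exact (le_abs_self _).trans (abs_pairing_le hF hF0 fun x hx =>
    (hX.abs_le_tv hN hw.1 hx).trans (hX.tv_le_seminorm hN w))

end Mesh

/-! ### Transfer of nodal values between two nearby meshes. -/

/-- A point that separates the two intervals must lie between their left end points or between their
right end points. -/
theorem abs_indicator_Ioo_sub_le {l r l' r' t : ℝ} :
    |(Ioo l r).indicator (fun _ => (1 : ℝ)) t - (Ioo l' r').indicator (fun _ => (1 : ℝ)) t| ≤
      (uIcc l l').indicator (fun _ => (1 : ℝ)) t + (uIcc r r').indicator (fun _ => (1 : ℝ)) t := by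
  have hp : ∀ s : Set ℝ, 0 ≤ s.indicator (fun _ => (1 : ℝ)) t := fun s =>
    indicator_nonneg (fun _ _ => zero_le_one) t
  by_cases h1 : t ∈ uIcc l l'
  · rw [indicator_of_mem h1]
    have : |(Ioo l r).indicator (fun _ => (1 : ℝ)) t - (Ioo l' r').indicator (fun _ => (1 : ℝ)) t|
        ≤ 1 := by
      simp only [indicator]
      split_ifs <;> norm_num
    linarith [hp (uIcc r r')]
  by_cases h2 : t ∈ uIcc r r'
  · rw [indicator_of_mem h2]
    have : |(Ioo l r).indicator (fun _ => (1 : ℝ)) t - (Ioo l' r').indicator (fun _ => (1 : ℝ)) t|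
        ≤ 1 := by
      simp only [indicator]
      split_ifs <;> norm_num
    linarith [hp (uIcc l l')]
  have h3 : t ∈ Ioo l r ↔ t ∈ Ioo l' r' := by
    simp only [mem_uIcc, mem_Ioo, not_or, not_and, not_le] at *
    constructor <;> rintro ⟨h, h'⟩ <;> constructor <;> by_contra! h''
    · linarith [h1.1 h.le]
    · linarith [h2.2 h'']
    · linarith [h1.2 h.le]
    · linarith [h2.1 h'']
  have : (Ioo l r).indicator (fun _ => (1 : ℝ)) t = (Ioo l' r').indicator (fun _ => (1 : ℝ)) t := by
    simp only [indicator, h3]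
  rw [this, sub_self, abs_zero]
  exact add_nonneg (hp _) (hp _)

theorem integral_indicator_uIcc_le (x y : ℝ) :
    ∫ t in Omega, (uIcc x y).indicator (fun _ => (1 : ℝ)) t ≤ |x - y| := by
  rw [integral_indicator_const _ measurableSet_uIcc, smul_eq_mul, mul_one]
  have h : volume.real (uIcc x y) = |x - y| := by
    rw [Measure.real, Real.volume_interval, ENNReal.toReal_ofReal (abs_nonneg _), abs_sub_comm]
  rw [← h]
  refine ENNReal.toReal_mono ?_ (Measure.restrict_apply_le _ _)
  rw [Real.volume_interval]
  exact ENNReal.ofReal_ne_top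

theorem integral_lin_comb {f g h : ℝ → ℝ} (hf : Integrable f volOmega) (hg : Integrable g volOmega)
    (hh : Integrable h volOmega) (A B C k : ℝ) :
    ∫ t in Omega, (A * f t + (B * g t + C * h t) + k) =
      A * (∫ t in Omega, f t) + (B * (∫ t in Omega, g t) + C * (∫ t in Omega, h t)) + k := by
  have e1 : Integrable (fun t => B * g t + C * h t) volOmega :=
    (hg.const_mul B).add (hh.const_mul C)
  have e2 : Integrable (fun t => A * f t + (B * g t + C * h t)) volOmega := (hf.const_mul A).add e1
  rw [integral_add e2 (integrable_const k), integral_add (hf.const_mul A) e1,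
    integral_add (hg.const_mul B) (hh.const_mul C), integral_const_mul, integral_const_mul,
    integral_const_mul, integral_const, volOmega_real, one_smul]

section Mesh
variable {N : ℕ} {X Y : Fin (N - 1) → ℝ}

/-- On each cell `p u - q w = (p - q) u + q (u - w)` for the indicators `u`, `w`. The first term is
a change of value; the second lives on two strips of width at most `δ`. -/
theorem IsMesh.integral_abs_step_sub_step_le (hX : IsMesh X) (hN : 1 ≤ N) {δ : ℝ}
    (hδ : ∀ j ≤ N, |node X j - node Y j| ≤ δ) (p q : ℕ → ℝ) :
    ∫ t in Omega, |step X p t - step Y q t| ≤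
      ∑ j ∈ Finset.range N, (|p j - q j| * len X j + |q j| * (2 * δ)) := by
  let ind : ℕ → ℝ → ℝ := fun j => (uIcc (node X j) (node Y j)).indicator (fun _ => (1 : ℝ))
  have hi : ∀ j, Integrable (ind j) volOmega := fun j =>
    (integrable_const _).indicator measurableSet_uIcc
  have hle : ∀ j ≤ N, ∫ t in Omega, ind j t ≤ δ := fun j hj =>
    (integral_indicator_uIcc_le _ _).trans (hδ j hj)
  have h1 : ∀ t, |step X p t - step Y q t| ≤ step X (fun j => |p j - q j|) t +
      ∑ j ∈ Finset.range N, |q j| * (ind j t + ind (j + 1) t) := by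
    intro t
    unfold step
    rw [← Finset.sum_sub_distrib, ← Finset.sum_add_distrib]
    refine (Finset.abs_sum_le_sum_abs _ _).trans (Finset.sum_le_sum fun j _ => ?_)
    have e1 := abs_indicator_Ioo_sub_le (l := node X j) (r := node X (j + 1)) (l' := node Y j)
      (r' := node Y (j + 1)) (t := t)
    have e2 : ∀ (s : Set ℝ) (k : ℝ), s.indicator (fun _ => k) t =
        k * s.indicator (fun _ => (1 : ℝ)) t := fun s k => by
      by_cases h : t ∈ s <;> simp [h]
    unfold cell
    rw [e2 _ (p j), e2 _ (q j), e2 _ (|p j - q j|)]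
    have e3 : 0 ≤ (Ioo (node X j) (node X (j + 1))).indicator (fun _ => (1 : ℝ)) t :=
      indicator_nonneg (fun _ _ => zero_le_one) t
    set u := (Ioo (node X j) (node X (j + 1))).indicator (fun _ => (1 : ℝ)) t
    set w := (Ioo (node Y j) (node Y (j + 1))).indicator (fun _ => (1 : ℝ)) t
    calc |p j * u - q j * w| = |(p j - q j) * u + q j * (u - w)| := by congr 1; ring
      _ ≤ |(p j - q j) * u| + |q j * (u - w)| := abs_add_le _ _
      _ = |p j - q j| * u + |q j| * |u - w| := by rw [abs_mul, abs_mul, abs_of_nonneg e3]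
      _ ≤ _ := by gcongr
  have h2 : ∀ j ∈ Finset.range N,
      Integrable (fun t => |q j| * (ind j t + ind (j + 1) t)) volOmega :=
    fun j _ => ((hi j).add (hi (j + 1))).const_mul _
  calc ∫ t in Omega, |step X p t - step Y q t|
      ≤ ∫ t in Omega, (step X (fun j => |p j - q j|) t +
        ∑ j ∈ Finset.range N, |q j| * (ind j t + ind (j + 1) t)) :=
        integral_mono ((integrable_step p).sub (integrable_step q)).abs
          ((integrable_step _).add (integrable_finsetSum _ h2)) h1
    _ = ∑ j ∈ Finset.range N, (|p j - q j| * len X j +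
        |q j| * ((∫ t in Omega, ind j t) + ∫ t in Omega, ind (j + 1) t)) := by
        rw [integral_add (integrable_step _) (integrable_finsetSum _ h2), hX.integral_step hN,
          integral_finsetSum _ h2, ← Finset.sum_add_distrib]
        refine Finset.sum_congr rfl fun j _ => ?_
        rw [integral_const_mul, integral_add (hi j) (hi (j + 1))]
    _ ≤ _ := by
        refine Finset.sum_le_sum fun j hj => ?_
        have := hle j (Finset.mem_range.1 hj).le
        have := hle (j + 1) (Finset.mem_range.1 hj)
        gcongr
        linarith

theorem slope_mul_len {X : Fin (N - 1) → ℝ} (hX : IsMesh X) (v : ℝ → ℝ) {j : ℕ} (hj : j < N) :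
    slope X v j * len X j = v (node X (j + 1)) - v (node X j) :=
  div_mul_cancel₀ _ (hX.len_pos hj).ne'

/-- `v` on the mesh `X` and `w` on the mesh `Y` have the same nodal values. -/
def SameNodal {N : ℕ} (X Y : Fin (N - 1) → ℝ) (v w : ℝ → ℝ) : Prop :=
  ∀ j ≤ N, v (node X j) = w (node Y j)

theorem SameNodal.slope_eq {v w : ℝ → ℝ} (h : SameNodal X Y v w) (hY : IsMesh Y) {j : ℕ}
    (hj : j < N) : slope X v j = slope Y w j * len Y j / len X j := by
  rw [slope_mul_len hY w hj, ← h _ hj, ← h _ hj.le]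
  rfl

/-- The total variation is the sum of the absolute nodal increments, whatever the positions of the
nodes. -/
theorem SameNodal.tv_eq {v w : ℝ → ℝ} (h : SameNodal X Y v w) (hX : IsMesh X) (hY : IsMesh Y) :
    tv X v = tv Y w := by
  refine Finset.sum_congr rfl fun j hj => ?_
  have hj' := Finset.mem_range.1 hj
  have hx := hX.len_pos hj'
  have hy := hY.len_pos hj'
  rw [h.slope_eq hY hj', abs_div, abs_mul, abs_of_pos hx, abs_of_pos hy]
  field_simp

theorem abs_len_sub_len_le {δ : ℝ} (hδ : ∀ j ≤ N, |node X j - node Y j| ≤ δ) {j : ℕ} (hj : j < N) :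
    |len X j - len Y j| ≤ 2 * δ := by
  have h1 := hδ j hj.le
  have h2 := hδ (j + 1) hj
  unfold len
  rw [abs_le] at *
  constructor <;> linarith [h1.1, h1.2, h2.1, h2.2]

/-- Per cell, the change of slope and the displaced strips each cost at most `2 δ` times the slope;
`1 ≤ κ * len` turns the sum into a multiple of the variation on that cell. -/
theorem SameNodal.integral_abs_slope_sub_le {v w : ℝ → ℝ} (h : SameNodal X Y v w) (hX : IsMesh X)
    (hY : IsMesh Y) (hN : 1 ≤ N) {δ κ : ℝ} (hδ : ∀ j ≤ N, |node X j - node Y j| ≤ δ)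
    (hδ0 : 0 ≤ δ) (hκ : ∀ j < N, 1 ≤ κ * len Y j) :
    ∫ t in Omega, |step X (slope X v) t - step Y (slope Y w) t| ≤ 4 * δ * κ * tv Y w := by
  refine (hX.integral_abs_step_sub_step_le hN hδ _ _).trans ?_
  unfold tv
  rw [Finset.mul_sum]
  refine Finset.sum_le_sum fun j hj => ?_
  have hj' := Finset.mem_range.1 hj
  have hx := hX.len_pos hj'
  have hy := hY.len_pos hj'
  have hd := abs_len_sub_len_le hδ hj'
  -- Both slopes come from the same increment: slope times length agrees on the two meshes.
  have e : |slope X v j - slope Y w j| * len X j = |slope Y w j| * |len X j - len Y j| := by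
    rw [h.slope_eq hY hj', ← abs_of_pos hx, ← abs_mul, ← abs_mul, ← abs_neg]
    congr 1
    rw [abs_of_pos hx]
    field_simp
    ring
  rw [e]
  have hk := mul_le_mul_of_nonneg_left (hκ j hj') (mul_nonneg hδ0 (abs_nonneg (slope Y w j)))
  have := mul_le_mul_of_nonneg_left hd (abs_nonneg (slope Y w j))
  linarith

/-- Treating the product as one step function avoids an `L²` estimate of the slope differences,
which the strips would spoil. The constant is `4` from the changed values plus `2` from the strips;
Cauchy–Schwarz over the cells gives the seminorms. -/
theorem SameNodal.integral_abs_slope_mul_slope_sub_le {v w v' w' : ℝ → ℝ} (h : SameNodal X Y v w)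
    (h' : SameNodal X Y v' w') (hX : IsMesh X)
    (hY : IsMesh Y) (hN : 1 ≤ N) {δ κ : ℝ} (hδ : ∀ j ≤ N, |node X j - node Y j| ≤ δ)
    (hδ0 : 0 ≤ δ) (hκX : ∀ j < N, 1 ≤ κ * len X j) (hκY : ∀ j < N, 1 ≤ κ * len Y j) :
    ∫ t in Omega, |step X (slope X v) t * step X (slope X v') t -
        step Y (slope Y w) t * step Y (slope Y w') t| ≤
      6 * δ * κ * (seminorm Y w * seminorm Y w') := by
  have h0 : ∫ t in Omega, |step X (slope X v) t * step X (slope X v') t -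
        step Y (slope Y w) t * step Y (slope Y w') t| =
      ∫ t in Omega, |step X (fun j => slope X v j * slope X v' j) t -
        step Y (fun j => slope Y w j * slope Y w' j) t| := by
    refine integral_congr_ae ?_
    filter_upwards [hX.step_mul_step hN (slope X v) (slope X v'),
      hY.step_mul_step hN (slope Y w) (slope Y w')] with t h1 h2
    rw [h1, h2]
  rw [h0]
  refine (hX.integral_abs_step_sub_step_le hN hδ _ _).trans ?_
  have hκ0 : 0 ≤ κ := by
    have h1 := hκX 0 (by omega)
    have h2 := hX.len_pos (j := 0) (by omega)
    by_contra! h3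
    linarith [mul_neg_of_neg_of_pos h3 h2]
  refine le_trans ?_ (mul_le_mul_of_nonneg_left (hY.sum_mul_le (slope Y w) (slope Y w'))
    (mul_nonneg (mul_nonneg (by norm_num : (0 : ℝ) ≤ 6) hδ0) hκ0))
  rw [Finset.mul_sum]
  refine Finset.sum_le_sum fun j hj => ?_
  have hj' := Finset.mem_range.1 hj
  have hx := hX.len_pos hj'
  have hy := hY.len_pos hj'
  have hd := abs_len_sub_len_le hδ hj'
  have hkx := hκX j hj'
  have hky := hκY j hj'
  rw [h.slope_eq hY hj', h'.slope_eq hY hj', abs_mul (slope Y w j)]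
  set s := slope Y w j
  set s' := slope Y w' j
  set x := len X j
  set y := len Y j
  have e : |s * y / x * (s' * y / x) - s * s'| * x =
      |s| * |s'| * (|x - y| * (1 + y / x)) := by
    have : s * y / x * (s' * y / x) - s * s' = -(s * s' * ((x - y) * (1 + y / x))) / x := by
      field_simp
      ring
    rw [this, abs_div, abs_neg, abs_mul, abs_mul, abs_mul, abs_of_pos hx,
      abs_of_pos (by positivity : 0 < 1 + y / x), div_mul_cancel₀ _ hx.ne']
  rw [e]
  have e2 : y / x ≤ κ * y := by
    rw [div_le_iff₀ hx]
    nlinarith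
  -- Both `1` and `y / x` are at most `κ * y`, by the lower bounds for the two cell lengths.
  have e3 : |x - y| * (1 + y / x) ≤ 2 * δ * (2 * (κ * y)) := by
    gcongr
    linarith
  have e4 : 0 ≤ |s| * |s'| := by positivity
  have e5 := mul_le_mul_of_nonneg_left e3 e4
  have e6 := mul_le_mul_of_nonneg_left hky (mul_nonneg e4 hδ0)
  linarith

theorem SameNodal.abs_sub_le {v w : ℝ → ℝ} (h : SameNodal X Y v w) (hX : IsMesh X)
    (hY : IsMesh Y) (hN : 1 ≤ N) (hv : v ∈ feSpace X) (hw : w ∈ feSpace Y) {δ κ : ℝ}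
    (hδ : ∀ j ≤ N, |node X j - node Y j| ≤ δ)
    (hδ0 : 0 ≤ δ) (hκ : ∀ j < N, 1 ≤ κ * len Y j) {t : ℝ} (ht : t ∈ Icc (0 : ℝ) 1) :
    |v t - w t| ≤ 4 * δ * κ * tv Y w := by
  have hv' := feSpace_ac hv
  have hw' := feSpace_ac hw
  have hsub : AC (fun t => v t - w t) := AbsolutelyContinuousOnInterval.fun_sub hv' hw'
  refine (hsub.abs_le (by simp [hX.feSpace_zero hv, hY.feSpace_zero hw]) ht).trans ?_
  refine le_trans (le_of_eq ?_) (h.integral_abs_slope_sub_le hX hY hN hδ hδ0 hκ)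
  refine integral_congr_ae ?_
  filter_upwards [hX.deriv_feSpace hN hv, hY.deriv_feSpace hN hw, hv'.ae_differentiableAt,
    hw'.ae_differentiableAt] with x h1 h2 h3 h4
  rw [deriv_fun_sub h3 h4, h1, h2]

/-- The leading term uses the `L¹` closeness of slope products, the lower-order terms the `L¹`
closeness of slopes and the uniform closeness of values. -/
theorem SameNodal.abs_bilin_sub_le {v w v' w' a b c : ℝ → ℝ} (h : SameNodal X Y v w)
    (h' : SameNodal X Y v' w') (hX : IsMesh X) (hY : IsMesh Y) (hN : 1 ≤ N)
    (hv : v ∈ feSpace X) (hw : w ∈ feSpace Y) (hv' : v' ∈ feSpace X) (hw' : w' ∈ feSpace Y)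
    (ha : MemLp a ⊤ volOmega) (hb : MemLp b ⊤ volOmega) (hc : MemLp c ⊤ volOmega) {A B C : ℝ}
    (hA0 : 0 ≤ A) (hB0 : 0 ≤ B) (hC0 : 0 ≤ C)
    (hA : ∀ᵐ x ∂volOmega, |a x| ≤ A) (hB : ∀ᵐ x ∂volOmega, |b x| ≤ B)
    (hC : ∀ᵐ x ∂volOmega, |c x| ≤ C) {δ κ : ℝ} (hδ : ∀ j ≤ N, |node X j - node Y j| ≤ δ)
    (hδ0 : 0 ≤ δ) (hκX : ∀ j < N, 1 ≤ κ * len X j) (hκY : ∀ j < N, 1 ≤ κ * len Y j) :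
    |bilin a b c v v' - bilin a b c w w'| ≤
      (6 * A + 8 * B + 8 * C) * (δ * κ) * (seminorm Y w * seminorm Y w') := by
  have hvl := hX.memLp_weakDeriv hN hv
  have hwl := hY.memLp_weakDeriv hN hw
  have hvl' := hX.memLp_weakDeriv hN hv'
  have hwl' := hY.memLp_weakDeriv hN hw'
  unfold bilin
  rw [← integral_sub (integrable_bilin ha hb hc (feSpace_ac hv).integrable
      (hvl.integrable le_top) (feSpace_ac hv').memLp_top hvl')
    (integrable_bilin ha hb hc (feSpace_ac hw).integrable
      (hwl.integrable le_top) (feSpace_ac hw').memLp_top hwl')]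
  set T := tv Y w
  set T' := tv Y w'
  have hT0 : 0 ≤ T := hY.tv_nonneg w
  have hT0' : 0 ≤ T' := hY.tv_nonneg w'
  have hT : T ≤ seminorm Y w := hY.tv_le_seminorm hN w
  have hT' : T' ≤ seminorm Y w' := hY.tv_le_seminorm hN w'
  have hκ0 : 0 ≤ κ := by
    have h1 := hκX 0 (by omega)
    have h2 := hX.len_pos (j := 0) (by omega)
    by_contra! h3
    linarith [mul_neg_of_neg_of_pos h3 h2]
  set ε := 4 * δ * κ
  have hε : 0 ≤ ε := by positivity
  have i1 : Integrable (fun t => |step X (slope X v) t * step X (slope X v') t -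
        step Y (slope Y w) t * step Y (slope Y w') t|) volOmega :=
    ((integrable_step_mul _ (integrable_step _)).sub
      (integrable_step_mul _ (integrable_step _))).abs
  have i2 : Integrable (fun t => |step X (slope X v) t - step Y (slope Y w) t|) volOmega :=
    ((integrable_step _).sub (integrable_step _)).abs
  have i3 : Integrable (fun t => |step Y (slope Y w) t|) volOmega := (integrable_step _).abs
  have bound : ∀ᵐ t ∂volOmega,
      |(a t * weakDeriv v t * weakDeriv v' t + b t * weakDeriv v t * v' t + c t * v t * v' t) -
        (a t * weakDeriv w t * weakDeriv w' t + b t * weakDeriv w t * w' t + c t * w t * w' t)| ≤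
      A * |step X (slope X v) t * step X (slope X v') t -
        step Y (slope Y w) t * step Y (slope Y w') t| +
      (B * T' * |step X (slope X v) t - step Y (slope Y w) t| +
        B * (ε * T') * |step Y (slope Y w) t|) + C * (ε * T * T' + T * (ε * T')) := by
    filter_upwards [hA, hB, hC, hX.weakDeriv_feSpace hN hv, hX.weakDeriv_feSpace hN hv',
      hY.weakDeriv_feSpace hN hw, hY.weakDeriv_feSpace hN hw', ae_restrict_mem measurableSet_Ioo]
      with t a1 a2 a3 e1 e2 e3 e4 ht
    have ht' := Ioo_subset_Icc_self ht
    rw [e1, e2, e3, e4]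
    have b1 : |v t - w t| ≤ ε * T := h.abs_sub_le hX hY hN hv hw hδ hδ0 hκY ht'
    have b2 : |v' t - w' t| ≤ ε * T' := h'.abs_sub_le hX hY hN hv' hw' hδ hδ0 hκY ht'
    -- The total variation of `v'` on `X` equals that of `w'` on `Y`, so every bound refers to the
    -- mesh `Y`.
    have b3 : |v' t| ≤ T' := (hX.abs_le_tv hN hv' ht').trans_eq (h'.tv_eq hX hY)
    have b4 : |w t| ≤ T := hY.abs_le_tv hN hw ht'
    generalize step X (slope X v) t = p
    generalize step X (slope X v') t = p'
    generalize step Y (slope Y w) t = q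
    generalize step Y (slope Y w') t = q'
    calc |(a t * p * p' + b t * p * v' t + c t * v t * v' t) -
          (a t * q * q' + b t * q * w' t + c t * w t * w' t)|
        = |a t * (p * p' - q * q') + (b t * v' t * (p - q) + b t * (v' t - w' t) * q) +
          c t * ((v t - w t) * v' t + w t * (v' t - w' t))| := by congr 1; ring
      _ ≤ |a t * (p * p' - q * q')| + (|b t * v' t * (p - q)| + |b t * (v' t - w' t) * q|) +
          |c t * ((v t - w t) * v' t + w t * (v' t - w' t))| :=
          (abs_add_le _ _).trans (add_le_add_left ((abs_add_le _ _).trans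
            (add_le_add_right (abs_add_le _ _) _)) _)
      _ ≤ _ := by
          simp only [abs_mul]
          gcongr
          refine (abs_add_le _ _).trans ?_
          rw [abs_mul, abs_mul]
          gcongr
  have j1 := h.integral_abs_slope_mul_slope_sub_le h' hX hY hN hδ hδ0 hκX hκY
  have j2 := h.integral_abs_slope_sub_le hX hY hN hδ hδ0 hκY
  have j3 := hY.integral_abs_slope hN w
  refine abs_integral_le_integral_abs.trans ?_
  refine (integral_mono_of_nonneg (Filter.Eventually.of_forall fun _ => abs_nonneg _)
    (((i1.const_mul A).add ((i2.const_mul _).add (i3.const_mul _))).add (integrable_const _))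
    bound).trans ?_
  have eq : ∫ t in Omega, (A * |step X (slope X v) t * step X (slope X v') t -
        step Y (slope Y w) t * step Y (slope Y w') t| +
      (B * T' * |step X (slope X v) t - step Y (slope Y w) t| +
        B * (ε * T') * |step Y (slope Y w) t|) + C * (ε * T * T' + T * (ε * T'))) =
      A * (∫ t in Omega, |step X (slope X v) t * step X (slope X v') t -
        step Y (slope Y w) t * step Y (slope Y w') t|) +
      (B * T' * (∫ t in Omega, |step X (slope X v) t - step Y (slope Y w) t|) +
        B * (ε * T') * (∫ t in Omega, |step Y (slope Y w) t|)) +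
        C * (ε * T * T' + T * (ε * T')) := integral_lin_comb i1 i2 i3 _ _ _ _
  refine (le_of_eq eq).trans ?_
  rw [j3]
  have hTT : T * T' ≤ seminorm Y w * seminorm Y w' :=
    mul_le_mul hT hT' hT0' (seminorm_nonneg _)
  calc _ ≤ A * (6 * δ * κ * (seminorm Y w * seminorm Y w')) + (B * T' * (ε * T) +
        B * (ε * T') * T) + C * (ε * T * T' + T * (ε * T')) := by gcongr
    _ = A * (6 * δ * κ * (seminorm Y w * seminorm Y w')) + 2 * (B + C) * ε * (T * T') := by ring
    _ ≤ A * (6 * δ * κ * (seminorm Y w * seminorm Y w')) +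
        2 * (B + C) * ε * (seminorm Y w * seminorm Y w') := by gcongr
    _ = _ := by simp only [ε]; ring

end Mesh

/-! ### The perturbation estimate in `W^{1,1}`. -/

section Mesh
variable {N : ℕ} {X Y : Fin (N - 1) → ℝ}

/-- For a fixed nodal increment, a cell contributes increment squared over length, so only the ratio
of lengths enters. -/
theorem SameNodal.seminorm_le {v w : ℝ → ℝ} (h : SameNodal X Y v w) (hX : IsMesh X)
    (hY : IsMesh Y) {m : ℝ} (hm0 : 0 ≤ m) (hm : ∀ j < N, len X j ≤ m * len Y j) :
    seminorm Y w ≤ √m * seminorm X v := by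
  unfold seminorm
  rw [← Real.sqrt_mul hm0, Finset.mul_sum]
  refine Real.sqrt_le_sqrt (Finset.sum_le_sum fun j hj => ?_)
  have hj' := Finset.mem_range.1 hj
  have hx := hX.len_pos hj'
  have hy := hY.len_pos hj'
  rw [h.slope_eq hY hj']
  have : m * ((slope Y w j * len Y j / len X j) ^ 2 * len X j) =
      slope Y w j ^ 2 * len Y j * (m * len Y j / len X j) := by
    field_simp
  rw [this]
  refine le_mul_of_one_le_right (by positivity) ?_
  rw [one_le_div hx]
  exact hm j hj'

theorem IsMesh.sameNodal_interp (hX : IsMesh X) (hY : IsMesh Y) (hN : 1 ≤ N) {v : ℝ → ℝ}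
    (hv : v ∈ feSpace X) : SameNodal X Y v (interp Y fun j => v (node X j)) := fun j hj => by
  rw [hY.interp_node hN _ _ hj]
  · simp only [node_zero]; exact hX.feSpace_zero hv
  · simp only [node_last hN]; exact hX.feSpace_one hN hv

theorem SameNodal.symm {v w : ℝ → ℝ} (h : SameNodal X Y v w) : SameNodal Y X w v :=
  fun j hj => (h j hj).symm

theorem pairing_sub {f v w : ℝ → ℝ} (hf : MemLp f ⊤ volOmega) (hv : Integrable v volOmega)
    (hw : Integrable w volOmega) :
    pairing f (fun x => v x - w x) = pairing f v - pairing f w := by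
  unfold pairing
  rw [← integral_sub (integrable_memLp_top_mul hf hv) (integrable_memLp_top_mul hf hw)]
  simp only [mul_sub]

/-- Two finite element solutions on nearby meshes are close in `W^{1,1}`. -/
theorem integral_abs_weakDeriv_sub_le {a b c f uX uY : ℝ → ℝ} {a₀ A B C F δ κ m : ℝ}
    (hX : IsMesh X) (hY : IsMesh Y) (hN : 1 ≤ N)
    (ha : MemLp a ⊤ volOmega) (hb : MemW1 ⊤ b) (hc : MemLp c ⊤ volOmega)
    (hf : MemLp f ⊤ volOmega) (ha₀ : 0 < a₀) (haa₀ : ∀ᵐ x ∂volOmega, a₀ ≤ a x)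
    (hcb : ∀ᵐ x ∂volOmega, 0 ≤ c x - 1 / 2 * weakDeriv b x)
    (hA0 : 0 ≤ A) (hB0 : 0 ≤ B) (hC0 : 0 ≤ C) (hF0 : 0 ≤ F)
    (hA : ∀ᵐ x ∂volOmega, |a x| ≤ A) (hB : ∀ᵐ x ∂volOmega, |b x| ≤ B)
    (hC : ∀ᵐ x ∂volOmega, |c x| ≤ C) (hF : ∀ᵐ x ∂volOmega, |f x| ≤ F)
    (hδ : ∀ j ≤ N, |node X j - node Y j| ≤ δ)
    (hδ0 : 0 ≤ δ) (hκX : ∀ j < N, 1 ≤ κ * len X j) (hκY : ∀ j < N, 1 ≤ κ * len Y j)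
    (hm0 : 0 ≤ m) (hm : ∀ j < N, len X j ≤ m * len Y j)
    (huX : IsFESolution a b c f X uX) (huY : IsFESolution a b c f Y uY) :
    ∫ t in Omega, |weakDeriv (uX - uY) t| ≤
      (4 * (F / a₀) + (4 * F + (6 * A + 8 * B + 8 * C) * (√m * (F / a₀))) / a₀) * (δ * κ) := by
  set V := interp Y fun j => uX (node X j)
  have hV : V ∈ feSpace Y := interp_mem _
  have hUV : SameNodal X Y uX V := hX.sameNodal_interp hY hN huX.1
  set e := uY - V
  have he : e ∈ feSpace Y := Submodule.sub_mem _ huY.1 hV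
  set e' := interp X fun j => e (node Y j)
  have he' : e' ∈ feSpace X := interp_mem _
  have hee : SameNodal X Y e' e := (hY.sameNodal_interp hX hN he).symm
  have hκ0 : 0 ≤ κ := by
    have h1 := hκX 0 (by omega)
    have h2 := hX.len_pos (j := 0) (by omega)
    by_contra! h3
    linarith [mul_neg_of_neg_of_pos h3 h2]
  have hDX : seminorm X uX ≤ F / a₀ := by
    rw [le_div_iff₀' ha₀]
    exact hX.seminorm_solution_le hN ha hb hc haa₀ hcb hF hF0 huX
  have hDV : seminorm Y V ≤ √m * (F / a₀) :=
    (hUV.seminorm_le hX hY hm0 hm).trans (by gcongr)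
  set K := 6 * A + 8 * B + 8 * C
  have hK0 : 0 ≤ K := by positivity
  have h1 : |pairing f e' - pairing f e| ≤ F * (4 * δ * κ * seminorm Y e) := by
    rw [← pairing_sub hf (feSpace_ac he').integrable (feSpace_ac he).integrable]
    refine abs_pairing_le hF hF0 fun x hx =>
      (hee.abs_sub_le hX hY hN he' he hδ hδ0 hκY hx).trans ?_
    have := hY.tv_le_seminorm hN e
    gcongr
  have h2 := hUV.abs_bilin_sub_le hee hX hY hN huX.1 hV he' he ha hb.1 hc hA0 hB0 hC0 hA hB hC
    hδ hδ0 hκX hκY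
  -- The equation on `Y` is tested with `e`, the one on `X` with its transfer `e'`; what remains are
  -- differences between transferred quantities.
  have h3 : bilin a b c e e = -(pairing f e' - pairing f e) +
      (bilin a b c uX e' - bilin a b c V e) := by
    rw [bilin_sub_left ha hb.1 hc (feSpace_ac huY.1) (feSpace_ac hV) (feSpace_ac he).memLp_top
      (hY.memLp_weakDeriv hN he), huX.2 e' he', huY.2 e he]
    ring
  have h4 : a₀ * seminorm Y e ≤ (4 * F + K * (√m * (F / a₀))) * (δ * κ) := by
    refine le_of_mul_sq_le (seminorm_nonneg e) (by positivity) ?_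
    refine (hY.coercive hN ha hb hc haa₀ hcb he).trans ?_
    rw [h3]
    have h5 := seminorm_nonneg (X := Y) e
    have h6 : K * (δ * κ) * (seminorm Y V * seminorm Y e) ≤
        K * (δ * κ) * (√m * (F / a₀) * seminorm Y e) := by gcongr
    linarith [neg_abs_le (pairing f e' - pairing f e),
      le_abs_self (bilin a b c uX e' - bilin a b c V e)]
  have h5 : seminorm Y e ≤ (4 * F + K * (√m * (F / a₀))) / a₀ * (δ * κ) := by
    rw [div_mul_eq_mul_div, le_div_iff₀' ha₀]
    exact h4
  have h6 : ∀ᵐ t ∂volOmega, |weakDeriv (uX - uY) t| ≤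
      |step X (slope X uX) t - step Y (slope Y V) t| + |step Y (slope Y e) t| := by
    filter_upwards [weakDeriv_sub (feSpace_ac huX.1) (feSpace_ac huY.1),
      weakDeriv_sub (feSpace_ac huY.1) (feSpace_ac hV), hX.weakDeriv_feSpace hN huX.1,
      hY.weakDeriv_feSpace hN hV, hY.weakDeriv_feSpace hN he] with t e1 e2 e3 e4 e5
    rw [e1, ← e5, e2, ← e3, ← e4]
    refine le_trans (le_of_eq ?_) (abs_sub _ _)
    congr 1
    ring
  have i1 : Integrable (fun t => |step X (slope X uX) t - step Y (slope Y V) t|) volOmega :=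
    ((integrable_step _).sub (integrable_step _)).abs
  have i2 : Integrable (fun t => |step Y (slope Y e) t|) volOmega := (integrable_step _).abs
  refine (integral_mono_of_nonneg (Filter.Eventually.of_forall fun _ => abs_nonneg _)
    (i1.add i2) h6).trans ?_
  refine (integral_add i1 i2).le.trans ?_
  rw [hY.integral_abs_slope hN]
  have h7 := hUV.integral_abs_slope_sub_le hX hY hN hδ hδ0 hκY
  -- Passing to the variation of `uX` itself avoids the factor `√m` in this term.
  rw [← hUV.tv_eq hX hY] at h7
  have h8 : tv X uX ≤ F / a₀ := (hX.tv_le_seminorm hN uX).trans hDX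
  have h9 : 4 * δ * κ * tv X uX ≤ 4 * δ * κ * (F / a₀) := by gcongr
  have := hY.tv_le_seminorm hN e
  linarith

end Mesh

/-! ### Interpolation error and the second-order `L¹` estimate. -/

/-- Continuity of `P` upgrades an almost everywhere derivative to a classical one, as the mean value
theorem requires: `g` is a constant plus the primitive of `P`. -/
theorem AC.hasDerivAt_of_deriv_ae {g P : ℝ → ℝ} (hg : AC g) (hP : ContinuousOn P (Icc 0 1))
    (h : deriv g =ᵐ[volOmega] P) {t : ℝ} (ht : t ∈ Omega) : HasDerivAt g (P t) t := by
  have hi : IntervalIntegrable P volume 0 t :=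
    (hP.mono (by rw [uIcc_of_le ht.1.le]; exact Icc_subset_Icc le_rfl ht.2.le)).intervalIntegrable
  have h1 : HasDerivAt (fun s => ∫ x in (0 : ℝ)..s, P x) (P t) t :=
    intervalIntegral.integral_hasDerivAt_right hi
      ((hP.mono Ioo_subset_Icc_self).stronglyMeasurableAtFilter isOpen_Ioo t ht)
      ((hP t (Ioo_subset_Icc_self ht)).continuousAt (Icc_mem_nhds ht.1 ht.2))
  refine (h1.const_add (g 0)).congr_of_eventuallyEq ?_
  filter_upwards [isOpen_Ioo.mem_nhds ht] with s hs
  have h2 := hg.sub_eq_integral le_rfl hs.1.le hs.2.le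
  rw [intervalIntegral.integral_of_le hs.1.le, integral_Ioc_eq_integral_Ioo]
  have h3 : ∫ x in Ioo 0 s, deriv g x = ∫ x in Ioo 0 s, P x :=
    integral_congr_ae (ae_restrict_of_ae_restrict_of_subset (Ioo_subset_Ioo le_rfl hs.2.le) h)
  linarith

theorem integral_mul_le_sqrt_mul_sqrt {p q : ℝ → ℝ} (hp : MemLp p 2 volOmega)
    (hq : MemLp q 2 volOmega) :
    ∫ t in Omega, |p t| * |q t| ≤
      √(∫ t in Omega, p t ^ 2) * √(∫ t in Omega, q t ^ 2) := by
  have := integral_mul_le_Lp_mul_Lq_of_nonneg (μ := volOmega) (f := fun t => |p t|)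
    (g := fun t => |q t|) Real.HolderConjugate.two_two
    (Filter.Eventually.of_forall fun _ => abs_nonneg _)
    (Filter.Eventually.of_forall fun _ => abs_nonneg _)
    (by simpa using! hp.abs) (by simpa using! hq.abs)
  simpa [Real.sqrt_eq_rpow] using this

section Mesh
variable {N : ℕ} {X : Fin (N - 1) → ℝ}

/-- The error of piecewise linear interpolation. -/
theorem IsMesh.abs_sub_interp_le (hX : IsMesh X) {g P I : ℝ → ℝ}
    (hg : AC g) (hP : AC P) (hgP : ∀ t ∈ Omega, HasDerivAt g (P t) t) (hI : I ∈ feSpace X)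
    (hgI : SameNodal X X g I) {j : ℕ} (hj : j < N) {t : ℝ} (ht : t ∈ cell X j) :
    |g t - I t| ≤ len X j * ∫ x in cell X j, |deriv P x| := by
  have hN : 1 ≤ N := by omega
  have hlt := hX j hj
  have hlen := hX.len_pos hj
  have hl := (hX.node_mem hj.le hN).1
  have hr := (hX.node_mem (j := j + 1) hj hN).2
  have hsub : Icc (node X j) (node X (j + 1)) ⊆ Icc 0 1 := Icc_subset_Icc hl hr
  -- The slope of `I` on the cell is attained by `P` at some `ξ`, so the derivative of the error is
  -- `P x - P ξ`, controlled by the variation of `P` on the cell.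
  obtain ⟨ξ, hξ, hξ'⟩ := exists_hasDerivAt_eq_slope g P hlt (hg.continuousOn_Icc.mono hsub)
    (fun x hx => hgP x (hX.cell_subset hj hx))
  have hs : P ξ = slope X I j := by
    rw [hξ', hgI _ hj, hgI _ hj.le]
    rfl
  set Q := ∫ x in cell X j, |deriv P x|
  have hz : AC (fun x => g x - I x) := AbsolutelyContinuousOnInterval.fun_sub hg (feSpace_ac hI)
  have h1 := hz.abs_sub_le hl hr (left_mem_Icc.2 hlt.le) (Ioo_subset_Icc_self ht)
  rw [hgI _ hj.le, sub_self, sub_zero] at h1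
  refine h1.trans ?_
  have h2 : ∀ x ∈ cell X j, ‖|deriv (fun x => g x - I x) x|‖ ≤ Q := by
    intro x hx
    have hI' : HasDerivAt I (deriv I x) x := by
      obtain ⟨p, q, h⟩ := hX.feSpace_affine hI hj
      have : I =ᶠ[nhds x] fun t => p * t + q := by
        filter_upwards [isOpen_Ioo.mem_nhds hx] with s hs
        exact h s (Ioo_subset_Icc_self hs)
      exact (this.differentiableAt_iff.2 (by fun_prop)).hasDerivAt
    rw [Real.norm_eq_abs, abs_abs, ((hgP x (hX.cell_subset hj hx)).fun_sub hI').deriv,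
      hX.deriv_feSpace_of_mem hI hj hx, ← hs]
    exact hP.abs_sub_le hl hr (Ioo_subset_Icc_self hξ) (Ioo_subset_Icc_self hx)
  have h3 := norm_setIntegral_le_of_norm_le_const (μ := volume) (s := cell X j) (by
    unfold cell; simp) h2
  refine (le_abs_self _).trans (h3.trans (le_of_eq ?_))
  unfold cell len
  rw [mul_comm]
  simp [hlt.le]

/-- The weighted `L¹` error of piecewise linear interpolation. -/
theorem IsMesh.integral_step_mul_abs_sub_interp_le (hX : IsMesh X) (hN : 1 ≤ N) {g P I : ℝ → ℝ}
    (hg : AC g) (hP : AC P) (hgP : ∀ t ∈ Omega, HasDerivAt g (P t) t) (hI : I ∈ feSpace X)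
    (hgI : SameNodal X X g I) {H : ℝ} (hH : ∀ j < N, len X j ≤ H) {p : ℕ → ℝ}
    (hp : ∀ j, 0 ≤ p j) :
    ∫ t in Omega, step X p t * |g t - I t| ≤
      H ^ 2 * ∫ t in Omega, step X p t * |deriv P t| := by
  have hz : AC (fun x => g x - I x) := AbsolutelyContinuousOnInterval.fun_sub hg (feSpace_ac hI)
  rw [hX.integral_step_mul hN p hz.integrable.abs,
    hX.integral_step_mul hN p hP.integrable_deriv.abs, Finset.mul_sum]
  refine Finset.sum_le_sum fun j hj => ?_
  have hj' := Finset.mem_range.1 hj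
  have hlen := hX.len_pos hj'
  have hlt := hX j hj'
  set Q := ∫ x in cell X j, |deriv P x|
  have hQ : 0 ≤ Q := integral_nonneg fun _ => abs_nonneg _
  have h2 : ∀ x ∈ cell X j, ‖|g x - I x|‖ ≤ len X j * Q := fun x hx => by
    rw [Real.norm_eq_abs, abs_abs]
    exact hX.abs_sub_interp_le hg hP hgP hI hgI hj' hx
  have h3 := norm_setIntegral_le_of_norm_le_const (μ := volume) (s := cell X j) (by
    unfold cell; simp) h2
  have h4 : volume.real (cell X j) = len X j := by
    unfold cell len
    simp [hlt.le]
  rw [h4] at h3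
  have h5 := (le_abs_self _).trans h3
  have h6 : len X j * Q * len X j ≤ H ^ 2 * Q := by
    have : len X j * len X j ≤ H ^ 2 := by
      rw [sq]
      exact mul_le_mul (hH j hj') (hH j hj') hlen.le (hlen.le.trans (hH j hj'))
    nlinarith
  have := mul_le_mul_of_nonneg_left (h5.trans h6) (hp j)
  linarith

end Mesh

theorem AC.integrable_deriv_mul_add {g z : ℝ → ℝ} (hg : AC g) (hz : AC z) :
    Integrable (fun t => deriv g t * z t + g t * deriv z t) volOmega := by
  refine ((integrable_memLp_top_mul hz.memLp_top hg.integrable_deriv).add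
    (integrable_memLp_top_mul hg.memLp_top hz.integrable_deriv)).congr
    (Filter.Eventually.of_forall fun t => ?_)
  simp only [Pi.add_apply]
  ring

section Mesh
variable {N : ℕ} {X : Fin (N - 1) → ℝ}

/-- Integration by parts against a piecewise constant function. -/
theorem IsMesh.integral_step_mul_deriv_mul (hX : IsMesh X) (hN : 1 ≤ N) {g z : ℝ → ℝ} (hg : AC g)
    (hz : AC z) (h0 : ∀ j ≤ N, z (node X j) = 0) (p : ℕ → ℝ) :
    ∫ t in Omega, step X p t * (deriv g t * z t + g t * deriv z t) = 0 := by
  rw [hX.integral_step_mul hN p (hg.integrable_deriv_mul_add hz)]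
  refine Finset.sum_eq_zero fun j hj => ?_
  have hj' := Finset.mem_range.1 hj
  have hlt := hX j hj'
  have hsub : uIcc (node X j) (node X (j + 1)) ⊆ uIcc 0 1 := by
    rw [uIcc_of_le hlt.le, uIcc_of_le zero_le_one]
    exact Icc_subset_Icc (hX.node_mem hj'.le hN).1 (hX.node_mem (j := j + 1) hj' hN).2
  have h := AbsolutelyContinuousOnInterval.integral_deriv_mul_eq_sub
    (AbsolutelyContinuousOnInterval.mono hg hsub) (AbsolutelyContinuousOnInterval.mono hz hsub)
  rw [h0 _ hj', h0 _ hj'.le, intervalIntegral.integral_of_le hlt.le,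
    integral_Ioc_eq_integral_Ioo] at h
  unfold cell
  rw [h]
  ring

/-- The bilinear form of a function vanishing at the nodes with a finite element function. -/
theorem IsMesh.bilin_eq_of_node_eq_zero (hX : IsMesh X) (hN : 1 ≤ N) {a b c z e : ℝ → ℝ}
    (ha : MemW1 ⊤ a) (hb : MemW1 ⊤ b) (hc : MemLp c ⊤ volOmega) (hz : AC z)
    (h0 : ∀ j ≤ N, z (node X j) = 0) (he : e ∈ feSpace X) :
    bilin a b c z e = ∫ t in Omega, (c t * e t - weakDeriv b t * e t
      - (weakDeriv a t + b t) * step X (slope X e) t) * z t := by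
  obtain ⟨α, hα, haα, ha'⟩ := ha.exists_ac le_top
  obtain ⟨β, hβ, hbβ, hb'⟩ := hb.exists_ac le_top
  have heac := feSpace_ac he
  have he' := hX.memLp_weakDeriv hN he
  have k1 := hX.integral_step_mul_deriv_mul hN hα hz h0 (slope X e)
  have k2 := AbsolutelyContinuousOnInterval.integral_deriv_mul_eq_sub
    (AbsolutelyContinuousOnInterval.fun_mul hβ heac) hz
  have hz0 : z 0 = 0 := by simpa [node_zero] using h0 0 (Nat.zero_le N)
  have hz1 : z 1 = 0 := by simpa [node_last hN] using h0 N le_rfl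
  rw [intervalIntegral_eq_integral_Omega, hz0, hz1, mul_zero, mul_zero, sub_zero] at k2
  have i0 := integrable_bilin (a := a) (b := b) (c := c) (v := z) (e := e) ha.1 hb.1 hc
    hz.integrable hz.integrable_weakDeriv heac.memLp_top he'
  have i1 : Integrable (fun t => step X (slope X e) t * (deriv α t * z t + α t * deriv z t))
      volOmega := integrable_step_mul _ (hα.integrable_deriv_mul_add hz)
  have hβe : AC fun x => β x * e x := AbsolutelyContinuousOnInterval.fun_mul hβ heac
  have i2 : Integrable (fun t => deriv (fun x => β x * e x) t * z t + β t * e t * deriv z t)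
      volOmega := hβe.integrable_deriv_mul_add hz
  -- Two vanishing integrals are subtracted: that of `e' (a z)'`, zero cell by cell, and that of `(b
  -- e z)'`. Together they cancel every term containing `z'`.
  have : bilin a b c z e = bilin a b c z e
      - (∫ t in Omega, step X (slope X e) t * (deriv α t * z t + α t * deriv z t))
      - ∫ t in Omega, (deriv (fun x => β x * e x) t * z t + β t * e t * deriv z t) := by
    rw [k1, k2, sub_zero, sub_zero]
  rw [this]
  unfold bilin
  rw [← integral_sub i0 i1, ← integral_sub ?_ i2]
  swap
  · exact i0.sub i1
  refine integral_congr_ae ?_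
  filter_upwards [haα, ha', hbβ, hb', hz.weakDeriv_ae, hX.weakDeriv_feSpace hN he,
    hX.deriv_feSpace hN he, hβ.ae_differentiableAt, heac.ae_differentiableAt]
    with t e1 e2 e3 e4 e5 e6 e7 e8 e9
  rw [deriv_fun_mul e8 e9, e1, e2, e3, e4, e5, e6, e7]
  ring

/-- The `L¹` error of the finite element solution is of second order in the mesh size. -/
theorem IsMesh.integral_abs_sub_solution_le (hX : IsMesh X) (hN : 1 ≤ N)
    {a b c f u g P w : ℝ → ℝ} {a₀ A' B B' C H : ℝ}
    (ha : MemW1 ⊤ a) (hb : MemW1 ⊤ b) (hc : MemLp c ⊤ volOmega)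
    (ha₀ : 0 < a₀) (haa₀ : ∀ᵐ x ∂volOmega, a₀ ≤ a x)
    (hcb : ∀ᵐ x ∂volOmega, 0 ≤ c x - 1 / 2 * weakDeriv b x)
    (hA'0 : 0 ≤ A') (hB0 : 0 ≤ B) (hB'0 : 0 ≤ B') (hC0 : 0 ≤ C)
    (hA' : ∀ᵐ x ∂volOmega, |weakDeriv a x| ≤ A') (hB : ∀ᵐ x ∂volOmega, |b x| ≤ B)
    (hB' : ∀ᵐ x ∂volOmega, |weakDeriv b x| ≤ B') (hC : ∀ᵐ x ∂volOmega, |c x| ≤ C)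
    (hu : IsWeakSolution a b c f u) (hg : AC g) (hP : AC P)
    (hgP : ∀ t ∈ Omega, HasDerivAt g (P t) t) (hP2 : MemLp (deriv P) 2 volOmega)
    (hug : u =ᵐ[volOmega] g) (hug' : weakDeriv u =ᵐ[volOmega] deriv g) (hg0 : g 0 = 0)
    (hg1 : g 1 = 0) (hH : ∀ j < N, len X j ≤ H) (hw : IsFESolution a b c f X w) :
    ∫ t in Omega, |w t - g t| ≤
      (((A' + B) * √(∫ t in Omega, deriv P t ^ 2) + (B' + C) * ∫ t in Omega, |deriv P t|) / a₀ +
        ∫ t in Omega, |deriv P t|) * H ^ 2 := by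
  set Q₁ := ∫ t in Omega, |deriv P t|
  set Q₂ := √(∫ t in Omega, deriv P t ^ 2)
  have hQ₁ : 0 ≤ Q₁ := integral_nonneg fun _ => abs_nonneg _
  have hQ₂ : 0 ≤ Q₂ := Real.sqrt_nonneg _
  set I := interp X fun j => g (node X j)
  have hI : I ∈ feSpace X := interp_mem _
  have hgI : SameNodal X X g I := fun j hj => by
    refine (hX.interp_node (g := fun j => g (node X j)) hN ?_ ?_ hj).symm
    · simpa only [node_zero] using hg0
    · simpa only [node_last hN] using hg1
  set e := w - I
  have he : e ∈ feSpace X := Submodule.sub_mem _ hw.1 hI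
  have heac := feSpace_ac he
  have he' := hX.memLp_weakDeriv hN he
  have hIac := feSpace_ac hI
  have hz : AC (g - I) := AbsolutelyContinuousOnInterval.sub hg hIac
  -- Galerkin orthogonality: the finite element solution may be replaced by the representative `g`
  -- of `u`.
  have k1 : bilin a b c e e = bilin a b c (g - I) e := by
    rw [bilin_sub_left ha.1 hb.1 hc (feSpace_ac hw.1) hIac heac.memLp_top he',
      bilin_sub_left ha.1 hb.1 hc hg hIac heac.memLp_top he', hw.2 e he,
      ← hu.2 e (hX.memH10_feSpace hN he),
      bilin_congr_left hug (hug'.trans hg.weakDeriv_ae.symm)]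
  rw [hX.bilin_eq_of_node_eq_zero hN ha hb hc hz (fun j hj => by simp [hgI j hj]) he] at k1
  set D := seminorm X e
  have hD : 0 ≤ D := seminorm_nonneg e
  have hzi : Integrable (fun t => |g t - I t|) volOmega := hz.integrable.abs
  have i1 : Integrable (fun t => step X (fun j => |slope X e j|) t * |g t - I t|) volOmega :=
    integrable_step_mul _ hzi
  have l1 : ∫ t in Omega, |g t - I t| ≤ H ^ 2 * Q₁ := by
    have h := hX.integral_step_mul_abs_sub_interp_le hN hg hP hgP hI hgI hH (p := fun _ => 1)
      (fun _ => zero_le_one)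
    have h1 : ∀ᵐ t ∂volOmega, step X (fun _ => 1) t = 1 := by
      filter_upwards [ae_mem_cell (X := X) hN] with t ⟨j, hj, ht⟩
      exact hX.step_eq _ hj ht
    have h2 : ∀ q : ℝ → ℝ, ∫ t in Omega, step X (fun _ => 1) t * q t = ∫ t in Omega, q t :=
      fun q => integral_congr_ae (by filter_upwards [h1] with t ht; rw [ht, one_mul])
    rwa [h2, h2] at h
  -- Keeping the weight `|e'|` inside until the end lets Cauchy–Schwarz pair it with the `L²` norm
  -- of `P'`; the seminorm of `e` then factors out.
  have l2 : ∫ t in Omega, step X (fun j => |slope X e j|) t * |g t - I t| ≤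
      H ^ 2 * (D * Q₂) := by
    refine (hX.integral_step_mul_abs_sub_interp_le hN hg hP hgP hI hgI hH
      (fun _ => abs_nonneg _)).trans ?_
    refine mul_le_mul_of_nonneg_left ?_ (sq_nonneg H)
    have h := integral_mul_le_sqrt_mul_sqrt (memLp_step (X := X) (slope X e) 2) hP2
    rw [hX.integral_sq_slope hN, Real.sqrt_sq hD] at h
    refine le_trans (le_of_eq (integral_congr_ae ?_)) h
    filter_upwards [hX.abs_step hN (slope X e)] with t ht
    rw [ht]
  have key : bilin a b c e e ≤
      (C + B') * D * (H ^ 2 * Q₁) + (A' + B) * (H ^ 2 * (D * Q₂)) := by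
    rw [k1]
    have bound : ∀ᵐ t ∂volOmega, (c t * e t - weakDeriv b t * e t
        - (weakDeriv a t + b t) * step X (slope X e) t) * (g - I) t ≤
        (C + B') * D * |g t - I t| +
          (A' + B) * (step X (fun j => |slope X e j|) t * |g t - I t|) := by
      filter_upwards [hA', hB, hB', hC, hX.abs_step hN (slope X e),
        ae_restrict_mem measurableSet_Ioo] with t e1 e2 e3 e4 e5 ht
      have e6 : |e t| ≤ D := (hX.abs_le_tv hN he (Ioo_subset_Icc_self ht)).trans
        (hX.tv_le_seminorm hN e)
      rw [← e5, ← mul_assoc, ← add_mul, Pi.sub_apply]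
      refine (le_abs_self _).trans ?_
      rw [abs_mul]
      refine mul_le_mul_of_nonneg_right ?_ (abs_nonneg _)
      have h1 : |c t * e t| ≤ C * D := by rw [abs_mul]; gcongr
      have h2 : |weakDeriv b t * e t| ≤ B' * D := by rw [abs_mul]; gcongr
      have h3 : |(weakDeriv a t + b t) * step X (slope X e) t| ≤
          (A' + B) * |step X (slope X e) t| := by
        rw [abs_mul]
        gcongr
        exact (abs_add_le _ _).trans (by linarith)
      have h4 := abs_sub (c t * e t - weakDeriv b t * e t)
        ((weakDeriv a t + b t) * step X (slope X e) t)
      have h5 := abs_sub (c t * e t) (weakDeriv b t * e t)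
      linarith
    have i0 : Integrable (fun t => (c t * e t - weakDeriv b t * e t
        - (weakDeriv a t + b t) * step X (slope X e) t) * (g - I) t) volOmega :=
      integrable_memLp_top_mul (((memLp_top_mul hc heac.memLp_top).sub
        (memLp_top_mul hb.2.2 heac.memLp_top)).sub
        (memLp_top_mul (ha.2.2.add hb.1) (memLp_step _ ⊤))) hz.integrable
    refine (integral_mono_ae i0 ((hzi.const_mul _).add (i1.const_mul _)) bound).trans ?_
    refine (integral_add (hzi.const_mul _) (i1.const_mul _)).le.trans ?_
    rw [integral_const_mul, integral_const_mul]
    gcongr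
  have k2 : a₀ * D ≤ ((A' + B) * Q₂ + (B' + C) * Q₁) * H ^ 2 := by
    refine le_of_mul_sq_le hD (by positivity) ?_
    refine (hX.coercive hN ha.1 hb hc haa₀ hcb he).trans (key.trans (le_of_eq ?_))
    ring
  have k3 : D ≤ ((A' + B) * Q₂ + (B' + C) * Q₁) / a₀ * H ^ 2 := by
    rw [div_mul_eq_mul_div, le_div_iff₀' ha₀]
    exact k2
  have hfin : ∀ᵐ t ∂volOmega, |w t - g t| ≤ |g t - I t| + D := by
    filter_upwards [ae_restrict_mem measurableSet_Ioo] with t ht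
    have e6 : |e t| ≤ D := (hX.abs_le_tv hN he (Ioo_subset_Icc_self ht)).trans
      (hX.tv_le_seminorm hN e)
    have : w t - g t = e t - (g t - I t) := by simp [e]
    rw [this]
    linarith [abs_sub (e t) (g t - I t)]
  refine (integral_mono_of_nonneg (Filter.Eventually.of_forall fun _ => abs_nonneg _)
    (hzi.add (integrable_const D)) hfin).trans ?_
  refine (integral_add hzi (integrable_const D)).le.trans ?_
  rw [integral_const, volOmega_real, one_smul]
  linarith

end Mesh

/-! ### Admissible meshes, the regular representative and the main estimates. -/

theorem one_le_rho0 {γ : ℝ} (hγ : 0 < γ) (r : ℝ → ℝ) : 1 ≤ rho0 γ r := by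
  unfold rho0
  have : 0 ≤ γ * ((eLpNorm r ⊤ volOmega).toReal /
    (eLpNorm r (2 / 3) volOmega).toReal) ^ (2 / 3 : ℝ) := by positivity
  nlinarith

theorem abs_node_sub_node_le {N : ℕ} (X Y : Fin (N - 1) → ℝ) (j : ℕ) :
    |node X j - node Y j| ≤ ‖X - Y‖ := by
  unfold node
  split_ifs with h1 h2
  · simp
  · exact norm_le_pi_norm (X - Y) ⟨j - 1, h2⟩
  · simp

section MeshSet
variable {N : ℕ} {X Y : Fin (N - 1) → ℝ} {ρ : ℝ}

theorem isMesh_of_mem_meshSet (hX : X ∈ meshSet ρ N) : IsMesh X := fun j hj => (hX j hj).1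

theorem len_le_of_mem_meshSet (hX : X ∈ meshSet ρ N) {j : ℕ} (hj : j < N) : len X j ≤ 2 / N :=
  (hX j hj).2.2

theorem one_le_mul_len_of_mem_meshSet (hρ : 0 < ρ) (hX : X ∈ meshSet ρ N) {j : ℕ} (hj : j < N) :
    1 ≤ ρ * N * len X j := by
  have hN : (0 : ℝ) < N := by exact_mod_cast (by omega : 0 < N)
  have := (hX j hj).2.1
  rw [div_le_iff₀ (by positivity)] at this
  unfold len
  linarith

theorem len_le_mul_len_of_mem_meshSet (hρ : 0 < ρ) (hX : X ∈ meshSet ρ N) (hY : Y ∈ meshSet ρ N)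
    {j : ℕ} (hj : j < N) : len X j ≤ 2 * ρ * len Y j := by
  have hN : (0 : ℝ) < N := by exact_mod_cast (by omega : 0 < N)
  refine (len_le_of_mem_meshSet hX hj).trans ?_
  rw [div_le_iff₀ hN]
  linarith [one_le_mul_len_of_mem_meshSet hρ hY hj]

end MeshSet

/-- The solution has a continuously differentiable representative vanishing at the end points. -/
theorem exists_representative {u : ℝ → ℝ} (hu : MemH10 u) (hu2 : MemH2 u) :
    ∃ g P : ℝ → ℝ, AC g ∧ AC P ∧ (∀ t ∈ Omega, HasDerivAt g (P t) t) ∧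
      MemLp (deriv P) 2 volOmega ∧ u =ᵐ[volOmega] g ∧ weakDeriv u =ᵐ[volOmega] deriv g ∧
      g 0 = 0 ∧ g 1 = 0 := by
  obtain ⟨g, hg, hug, hug'⟩ := hu2.1.exists_ac one_le_two
  obtain ⟨P, hP, huP, huP'⟩ := hu2.2.exists_ac one_le_two
  obtain ⟨k, hk, huk, hk0, hk1⟩ := hu.2
  -- Two continuous representatives agree on the closed interval, so `g` inherits the boundary
  -- values of `k`.
  have hgk : EqOn g k (Icc 0 1) := by
    refine Measure.eqOn_Icc_of_ae_eq volume zero_ne_one ?_ hg.continuousOn_Icc hk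
    rw [← restrict_Ioo_eq_restrict_Icc]
    exact hug.symm.trans huk
  exact ⟨g, P, hg, hP,
    fun t ht => hg.hasDerivAt_of_deriv_ae hP.continuousOn_Icc (hug'.symm.trans huP) ht,
    hu2.2.2.2.ae_eq huP', hug, hug', (hgk (by simp)).trans hk0, (hgk (by simp)).trans hk1⟩

theorem eLpNorm_one_eq {v : ℝ → ℝ} (hv : Integrable v volOmega) :
    eLpNorm v 1 volOmega = ENNReal.ofReal (∫ t in Omega, |v t|) := by
  rw [eLpNorm_one_eq_lintegral_enorm, ← ofReal_integral_norm_eq_lintegral_enorm hv]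
  simp only [Real.norm_eq_abs]

theorem eLpNorm_two_eq {v : ℝ → ℝ} (hv : MemLp v 2 volOmega) :
    eLpNorm v 2 volOmega = ENNReal.ofReal √(∫ t in Omega, v t ^ 2) := by
  rw [hv.eLpNorm_eq_integral_rpow_norm two_ne_zero ENNReal.ofNat_ne_top]
  simp [Real.sqrt_eq_rpow]

theorem rpow_mul_rpow_eq_sqrt_div {n δ : ℝ} (hn : 0 ≤ n) (hδ : 0 ≤ δ) :
    n ^ (-(1 / 2) : ℝ) * δ ^ (1 / 2 : ℝ) = √(δ / n) := by
  rw [Real.rpow_neg hn, ← Real.sqrt_eq_rpow, ← Real.sqrt_eq_rpow, Real.sqrt_div hδ]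
  ring

/-- Interpolation between a `W^{1,1}` bound and an `L¹` bound. -/
theorem sqrt_integral_sq_le {w : ℝ → ℝ} (hw : AC w) (h0 : w 0 = 0) {L M : ℝ} (hL0 : 0 ≤ L)
    (hL : ∫ t in Omega, |weakDeriv w t| ≤ L) (hM : ∫ t in Omega, |w t| ≤ M) :
    √(∫ t in Omega, w t ^ 2) ≤ √(L * M) ∧ ∫ t in Omega, |w t| ≤ √(L * M) := by
  have hsup : ∀ᵐ t ∂volOmega, |w t| ≤ L := by
    filter_upwards [ae_restrict_mem measurableSet_Ioo] with t ht
    refine (hw.abs_le h0 (Ioo_subset_Icc_self ht)).trans (le_trans (le_of_eq ?_) hL)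
    refine integral_congr_ae ?_
    filter_upwards [hw.weakDeriv_ae] with x hx
    rw [hx]
  have hi : Integrable (fun t => |w t|) volOmega := hw.integrable.abs
  have hw0 : 0 ≤ ∫ t in Omega, |w t| := integral_nonneg fun _ => abs_nonneg _
  refine ⟨Real.sqrt_le_sqrt ?_, Real.le_sqrt_of_sq_le ?_⟩
  · refine (integral_mono_of_nonneg (Filter.Eventually.of_forall fun _ => sq_nonneg _)
      (hi.const_mul L) ?_).trans ?_
    · filter_upwards [hsup] with t ht
      rw [← sq_abs, sq]
      exact mul_le_mul_of_nonneg_right ht (abs_nonneg _)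
    · rw [integral_const_mul]
      exact mul_le_mul_of_nonneg_left hM hL0
  -- On a domain of measure one the sup bound `L` also bounds the `L¹` norm, so its square is at
  -- most `L * M`.
  · have h1 : ∫ t in Omega, |w t| ≤ L := by
      refine (integral_mono_ae hi (integrable_const L) hsup).trans (le_of_eq ?_)
      rw [integral_const, volOmega_real, one_smul]
    rw [sq]
    exact mul_le_mul h1 hM hw0 hL0

end FEMesh

end

theorem theorem2p3 (a b c f u : ℝ → ℝ) (a₀ γ : ℝ)
    (ha : FEMesh.MemW1 ⊤ a) (hb : FEMesh.MemW1 ⊤ b) (hc : MemLp c ⊤ FEMesh.volOmega)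
    (ha₀ : 0 < a₀) (haa₀ : ∀ᵐ x ∂FEMesh.volOmega, a₀ ≤ a x)
    (hcb : ∀ᵐ x ∂FEMesh.volOmega, 0 ≤ c x - 1 / 2 * FEMesh.weakDeriv b x)
    (hf : MemLp f ⊤ FEMesh.volOmega)
    (hu : FEMesh.IsWeakSolution a b c f u) (hu2 : FEMesh.MemH2 u) (hγ : 0 < γ) :
    ∃ C : ℝ, 0 < C ∧ ∀ (N : ℕ), 1 ≤ N → ∀ X Y : Fin (N - 1) → ℝ,
      X ∈ FEMesh.meshSet (FEMesh.rho0 γ (FEMesh.residual a b c f u)) N →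
      Y ∈ FEMesh.meshSet (FEMesh.rho0 γ (FEMesh.residual a b c f u)) N →
      ‖X - Y‖ < 1 / (FEMesh.rho0 γ (FEMesh.residual a b c f u) * N) →
      ∀ uX uY : ℝ → ℝ,
        FEMesh.IsFESolution a b c f X uX → FEMesh.IsFESolution a b c f Y uY →
        eLpNorm (FEMesh.weakDeriv (uX - uY)) 1 FEMesh.volOmega
            ≤ ENNReal.ofReal (C * N * ‖X - Y‖) ∧
        eLpNorm (uX - uY) 2 FEMesh.volOmega
            ≤ ENNReal.ofReal (C * (N : ℝ) ^ (-(1 / 2) : ℝ) * ‖X - Y‖ ^ (1 / 2 : ℝ)) ∧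
        |FEMesh.energySq a b c uX - FEMesh.energySq a b c uY|
            ≤ C * (N : ℝ) ^ (-(1 / 2) : ℝ) * ‖X - Y‖ ^ (1 / 2 : ℝ) := by
  open FEMesh in
  have hρ1 := one_le_rho0 hγ (residual a b c f u)
  set ρ := rho0 γ (residual a b c f u)
  have hρ : 0 < ρ := by linarith
  obtain ⟨A, hA0, hA⟩ := exists_ae_bound ha.1
  obtain ⟨A', hA'0, hA'⟩ := exists_ae_bound ha.2.2
  obtain ⟨B, hB0, hB⟩ := exists_ae_bound hb.1
  obtain ⟨B', hB'0, hB'⟩ := exists_ae_bound hb.2.2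
  obtain ⟨C, hC0, hC⟩ := exists_ae_bound hc
  obtain ⟨F, hF0, hF⟩ := exists_ae_bound hf
  obtain ⟨g, P, hg, hP, hgP, hP2, hug, hug', hg0, hg1⟩ := exists_representative hu.1 hu2
  -- The perturbation constant for `m = 2 * ρ` and `κ = ρ * N`, with the factor `N` taken out.
  set K₁ := (4 * (F / a₀) + (4 * F + (6 * A + 8 * B + 8 * C) * (√(2 * ρ) * (F / a₀))) / a₀) * ρ
    with hK₁
  have hK₁0 : 0 ≤ K₁ := by positivity
  set C₂ := ((A' + B) * √(∫ t in Omega, deriv P t ^ 2) + (B' + C) * ∫ t in Omega, |deriv P t|) / a₀ +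
    ∫ t in Omega, |deriv P t|
  have hC₂0 : 0 ≤ C₂ := by
    have : 0 ≤ ∫ t in Omega, |deriv P t| := integral_nonneg fun _ => abs_nonneg _
    positivity
  set S := √(K₁ * (8 * C₂))
  have hS : 0 ≤ S := Real.sqrt_nonneg _
  have hFS : 0 ≤ F * S := mul_nonneg hF0 hS
  -- One summand for each of the three estimates; the `1` ensures positivity.
  refine ⟨K₁ + S + F * S + 1, by positivity, fun N hN X Y hX hY _ uX uY huX huY => ?_⟩
  have hN0 : (0 : ℝ) < N := by exact_mod_cast hN
  have hXm := isMesh_of_mem_meshSet hX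
  have hYm := isMesh_of_mem_meshSet hY
  have hXac := feSpace_ac huX.1
  have hYac := feSpace_ac huY.1
  set δ := ‖X - Y‖
  have hδ0 : 0 ≤ δ := norm_nonneg _
  have hw : AC (uX - uY) := AbsolutelyContinuousOnInterval.sub hXac hYac
  have h1 : ∫ t in Omega, |weakDeriv (uX - uY) t| ≤ K₁ * N * δ := by
    refine (integral_abs_weakDeriv_sub_le hXm hYm hN ha.1 hb hc hf ha₀ haa₀ hcb hA0 hB0 hC0 hF0
      hA hB hC hF (fun j _ => abs_node_sub_node_le X Y j) hδ0
      (fun j hj => one_le_mul_len_of_mem_meshSet hρ hX hj)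
      (fun j hj => one_le_mul_len_of_mem_meshSet hρ hY hj) (by positivity : 0 ≤ 2 * ρ)
      (fun j hj => len_le_mul_len_of_mem_meshSet hρ hX hY hj) huX huY).trans (le_of_eq ?_)
    rw [hK₁]
    ring
  have hXg := hXm.integral_abs_sub_solution_le hN ha hb hc ha₀ haa₀ hcb hA'0 hB0 hB'0 hC0 hA' hB hB'
    hC hu hg hP hgP hP2 hug hug' hg0 hg1 (fun j hj => len_le_of_mem_meshSet hX hj) huX
  have hYg := hYm.integral_abs_sub_solution_le hN ha hb hc ha₀ haa₀ hcb hA'0 hB0 hB'0 hC0 hA' hB hB'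
    hC hu hg hP hgP hP2 hug hug' hg0 hg1 (fun j hj => len_le_of_mem_meshSet hY hj) huY
  -- Both solutions are compared with `g`; each error is `C₂ * (2 / N) ^ 2`, whence the `8`.
  have h2 : ∫ t in Omega, |(uX - uY) t| ≤ 8 * C₂ / N ^ 2 := by
    have i1 : Integrable (fun t => |uX t - g t|) volOmega :=
      (hXac.integrable.sub hg.integrable).abs
    have i2 : Integrable (fun t => |uY t - g t|) volOmega :=
      (hYac.integrable.sub hg.integrable).abs
    refine (integral_mono hw.integrable.abs (i1.add i2) fun t => ?_).trans
      ((integral_add i1 i2).le.trans ?_)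
    · have := abs_sub (uX t - g t) (uY t - g t)
      rwa [sub_sub_sub_cancel_right] at this
    · refine (add_le_add hXg hYg).trans (le_of_eq ?_)
      simp only [C₂]
      ring
  obtain ⟨h3, h4⟩ := sqrt_integral_sq_le hw
    (by simp [hXm.feSpace_zero huX.1, hYm.feSpace_zero huY.1]) (by positivity) h1 h2
  have h5 : √(K₁ * N * δ * (8 * C₂ / N ^ 2)) = S * √(δ / N) := by
    rw [← Real.sqrt_mul (by positivity)]
    congr 1
    field_simp
  rw [h5] at h3 h4
  have h6 : 0 ≤ √(δ / N) := Real.sqrt_nonneg _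
  refine ⟨?_, ?_, ?_⟩
  · rw [eLpNorm_one_eq hw.integrable_weakDeriv]
    refine ENNReal.ofReal_le_ofReal (h1.trans ?_)
    gcongr
    linarith
  · rw [eLpNorm_two_eq (hw.memLp_top.mono_exponent le_top), mul_assoc,
      rpow_mul_rpow_eq_sqrt_div hN0.le hδ0]
    refine ENNReal.ofReal_le_ofReal (h3.trans ?_)
    gcongr
    linarith
  -- Each energy is `B(u_h, u_h) = (f, u_h)`, so the quadratic difference becomes linear in `uX -
  -- uY`.
  · rw [mul_assoc, rpow_mul_rpow_eq_sqrt_div hN0.le hδ0,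
      ← bilin_self ha.1 hb hc hXac (hXm.memLp_weakDeriv hN huX.1) (hXm.feSpace_zero huX.1)
        (hXm.feSpace_one hN huX.1), huX.2 uX huX.1,
      ← bilin_self ha.1 hb hc hYac (hYm.memLp_weakDeriv hN huY.1) (hYm.feSpace_zero huY.1)
        (hYm.feSpace_one hN huY.1), huY.2 uY huY.1,
      ← pairing_sub hf hXac.integrable hYac.integrable]
    have h7 : |pairing f (fun x => uX x - uY x)| ≤ F * ∫ t in Omega, |(uX - uY) t| := by
      unfold pairing
      refine abs_integral_le_integral_abs.trans ?_
      rw [← integral_const_mul]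
      refine integral_mono_of_nonneg (Filter.Eventually.of_forall fun _ => abs_nonneg _)
        (hw.integrable.abs.const_mul F) ?_
      filter_upwards [hF] with t ht
      rw [abs_mul, Pi.sub_apply]
      exact mul_le_mul_of_nonneg_right ht (abs_nonneg _)
    refine h7.trans ((mul_le_mul_of_nonneg_left h4 hF0).trans ?_)
    rw [← mul_assoc]
    gcongr
    linarith
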